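/- Let $d\in\mathbf N$, let $\mathbf T^d=\mathbf R^d/(2\pi\mathbf Z)^d$ be the flat torus with Laplacian $\Delta$, and identify $T^*\mathbf T^d$ with $\mathbf T^d\times\mathbf R^d$ and functions on $\mathbf T^d$ with $2\pi\mathbf Z^d$-periodic functions on $\mathbf R^d$. For $a\in C_c^\infty(T^*\mathbf T^d)$ and $h>0$ let $\operatorname{op}_h(a)$ be the Weyl quantization, $$\operatorname{op}_h(a)u(x)=\int_{\mathbf R^d}\Big(\int_{\mathbf R^d}a\big(\tfrac{x+y}{2},h\xi\big)e^{i(x-y)\cdot\xi}\,\frac{d\xi}{(2\pi)^d}\Big)u(y)\,dy,\qquad u\in L^2(\mathbf T^d),$$ and let $(\cdot|\cdot)$ be the scalar product of $L^2(\mathbf T^d)$. Let $h\to0^+$ along a sequence, let $(\alpha_h)$ be any sequence of positive reals with $\alpha_h\to\infty$ (no other restriction is made on $\alpha_h$), and let $(u_h)$ be a bounded sequence in $L^2(\mathbf T^d)$ that is $h$-oscillating: for every $\phi\in C^\infty(\mathbf T^d)$, $$\limsup_{h\to0^+}\big\|\mathbf 1_{(-\infty,R)}(h^2\Delta)\,\phi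 u_h\big\|_{L^2(\mathbf T^d)}\to0\quad\text{as }R\to-\infty.$$ Suppose that $\mu_0$ is a positive Radon measure on $T^*\mathbf T^d$ with $$\lim_{h\to0^+}(\operatorname{op}_h(a)u_h|u_h)=\int a\,d\mu_0\qquad\text{for all }a\in C_c^\infty(T^*\mathbf T^d),$$ and that $\mu\in L^\infty(\mathbf R_t;\mathcal M_+(T^*\mathbf T^d))$, with values finite positive measures, satisfies $$\lim_{h\to0^+}\int_{\mathbf R}\varphi(t)\,\big(\operatorname{op}_h(a)e^{i\alpha_hht\Delta/2}u_h\,\big|\,e^{i\alpha_hht\Delta/2}u_h\big)\,dt=\int_{\mathbf R}\varphi(t)\int a(x,\xi)\,\mu(t,dx,d\xi)\,dt$$ for all $\varphi\in L^1(\mathbf R)$ and $a\in C_c^\infty(T^*\mathbf T^d)$. Let $$\Omega=\{\xi\in\mathbf R^d:\ k\cdot\xi=0\ \text{for some }k\in\mathbf Z^d\setminus\{0\}\}$$ be the set of resonant frequencies, and suppose that $\mu_0(\mathbf T^d\times\Omega)=0$. Then for every $a\in C_c^\infty(T^*\mathbf T^d)$ the average along the geodesic flow $$\langle a\rangle(x,\xi)=\lim_{T\to\infty}\frac1T\int_0^Ta(x+s\xi,\xi)\,ds$$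 exists at every $(x,\xi)\in T^*\mathbf T^d$ and is $\mu_0$-integrable; and for almost every $t\in\mathbf R$ and every $a\in C_c^\infty(T^*\mathbf T^d)$, $$\int_{T^*\mathbf T^d}a(x,\xi)\,\mu(t,dx,d\xi)=\int_{T^*\mathbf T^d}\langle a\rangle(x,\xi)\,\mu_0(dx,d\xi).$$ -/

import Mathlib

open MeasureTheory Filter Topology
open scoped ContDiff ENNReal NNReal Real

noncomputable section

namespace TorusSemiclassical

instance fact_two_pi_pos : Fact (0 < 2 * π) := ⟨Real.two_pi_pos⟩

/-- The flat torus `ℝᵈ / (2πℤ)ᵈ`. It carries the product (Riemannian) measure, of total mass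
`(2π)ᵈ`. -/
abbrev Torus (d : ℕ) : Type := Fin d → AddCircle (2 * π)

/-- Euclidean space `ℝᵈ`. -/
abbrev Euc (d : ℕ) : Type := EuclideanSpace ℝ (Fin d)

/-- The cotangent bundle `T*𝕋ᵈ`, identified with `𝕋ᵈ × ℝᵈ`. -/
abbrev Phase (d : ℕ) : Type := Torus d × Euc d

/-- The Hilbert space `L²(𝕋ᵈ)`. -/
abbrev L2 (d : ℕ) : Type := Lp ℂ 2 (volume : Measure (Torus d))

/-- The quotient map `ℝᵈ → 𝕋ᵈ`. -/
def proj {d : ℕ} (x : Euc d) : Torus d := fun i => (x i : AddCircle (2 * π))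

/-- Smooth functions on the torus: those whose periodic lift to `ℝᵈ` is smooth. -/
def IsSmooth {d : ℕ} (φ : Torus d → ℂ) : Prop :=
  ContDiff ℝ ∞ (fun x : Euc d => φ (proj x))

/-- The symbol class `C_c^∞(T*𝕋ᵈ)`. -/
def IsSymbol {d : ℕ} (a : Phase d → ℂ) : Prop :=
  ContDiff ℝ ∞ (fun p : Euc d × Euc d => a (proj p.1, p.2)) ∧ HasCompactSupport a

/-! ### Functional calculus of the Laplacian -/

/-- The plane wave `e^{ik·x}`, an eigenfunction of `Δ` with eigenvalue `-|k|²`. -/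
def planeWave {d : ℕ} (k : Fin d → ℤ) : C(Torus d, ℂ) where
  toFun x := ∏ i, fourier (k i) (x i)
  continuous_toFun := by fun_prop

/-- The Fourier coefficient `(2π)⁻ᵈ ∫ e^{-ik·x} u(x) dx`. -/
def coeff {d : ℕ} (u : Torus d → ℂ) (k : Fin d → ℤ) : ℂ :=
  ((2 * π : ℝ) : ℂ)⁻¹ ^ d * ∫ x, starRingEnd ℂ (planeWave k x) * u x

/-- `F(Δ) u = ∑ₖ F(-|k|²) û(k) e^{ik·x}` in `L²(𝕋ᵈ)`, for a bounded function `F` on the real line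
and a square integrable `u`. -/
def functionOfLaplacian {d : ℕ} (F : ℝ → ℂ) (u : Torus d → ℂ) : L2 d :=
  ∑' k : Fin d → ℤ,
    (F (-∑ i, (k i : ℝ) ^ 2) * coeff u k) • ContinuousMap.toLp 2 volume ℂ (planeWave k)

/-- The Schrödinger group `e^{isΔ/2}`. -/
def schrodinger {d : ℕ} (s : ℝ) (u : L2 d) : L2 d :=
  functionOfLaplacian (fun r => Complex.exp (Complex.I * s * r / 2)) u

/-- The spectral projector `1_{(-∞,R)}(h²Δ)`. -/
def highFrequencyProjector {d : ℕ} (h R : ℝ) (u : Torus d → ℂ) : L2 d :=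
  functionOfLaplacian (fun r => (Set.Iio R).indicator 1 (h ^ 2 * r)) u

/-! ### Weyl quantization and Wigner distributions -/

/-- The kernel `(2π)⁻ᵈ ∫ a((x+y)/2, hξ) e^{i(x-y)·ξ} dξ` of the Weyl quantization of `a`. -/
def weylKernel {d : ℕ} (h : ℝ) (a : Phase d → ℂ) (x y : Euc d) : ℂ :=
  ((2 * π : ℝ) : ℂ)⁻¹ ^ d *
    ∫ ξ : Euc d, a (proj ((2 : ℝ)⁻¹ • (x + y)), h • ξ) *
      Complex.exp (Complex.I * (inner ℝ (x - y) ξ : ℝ))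

/-- The Weyl operator `op_h(a)` acting on a function on the torus, viewed as a `2πℤᵈ`-periodic
function on `ℝᵈ`. The result is again periodic, and is given as a function on `ℝᵈ`. -/
def weylOp {d : ℕ} (h : ℝ) (a : Phase d → ℂ) (u : Torus d → ℂ) (x : Euc d) : ℂ :=
  ∫ y : Euc d, weylKernel h a x y * u (proj y)

/-- The Wigner distribution `⟨w_u^h, a⟩ = (op_h(a) u | u)`, the scalar product of `L²(𝕋ᵈ)` being
computed on the fundamental domain `[0,2π)ᵈ`. -/
def wigner {d : ℕ} (h : ℝ) (u : L2 d) (a : Phase d → ℂ) : ℂ :=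
  ∫ x in {x : Euc d | ∀ i, x i ∈ Set.Ico 0 (2 * π)}, weylOp h a u x * starRingEnd ℂ (u (proj x))

/-! ### Semiclassical measures -/

/-- The `h`-oscillation property. -/
def IsHOscillating {d : ℕ} (h : ℕ → ℝ) (u : ℕ → L2 d) : Prop :=
  ∀ φ : Torus d → ℂ, IsSmooth φ →
    Tendsto
      (fun R : ℝ => limsup
        (fun n => ‖highFrequencyProjector (h n) R (fun x => φ x * u n x)‖ₑ) atTop)
      atBot (𝓝 0)

/-- `μ₀` is the semiclassical measure of the sequence `(u n)` at scale `h n`. -/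
def IsSemiclassicalMeasure {d : ℕ} (h : ℕ → ℝ) (u : ℕ → L2 d) (μ₀ : Measure (Phase d)) : Prop :=
  ∀ a : Phase d → ℂ, IsSymbol a →
    Tendsto (fun n => wigner (h n) (u n) a) atTop (𝓝 (∫ p, a p ∂μ₀))

/-- `μ` belongs to `L^∞(ℝ; 𝓜₊(T*𝕋ᵈ))`. -/
def IsLInftyMeasureValued {d : ℕ} (μ : ℝ → Measure (Phase d)) : Prop :=
  AEMeasurable μ volume ∧ ∃ C : ℝ≥0, ∀ᵐ t, μ t Set.univ ≤ C

/-- `μ` is the limit, in the sense of averages in time, of the Wigner distributions of the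
solutions `e^{iα_h h t Δ/2} u_h`. -/
def IsEvolutionMeasure {d : ℕ} (h α : ℕ → ℝ) (u : ℕ → L2 d) (μ : ℝ → Measure (Phase d)) : Prop :=
  ∀ φ : ℝ → ℂ, Integrable φ → ∀ a : Phase d → ℂ, IsSymbol a →
    Tendsto
      (fun n => ∫ t, φ t * wigner (h n) (schrodinger (α n * h n * t) (u n)) a)
      atTop (𝓝 (∫ t, φ t * ∫ p, a p ∂(μ t)))

/-! ### Geodesic averages and resonant frequencies -/

/-- The geodesic flow `φ_s(x, ξ) = (x + sξ, ξ)`. -/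
def geodesicFlow {d : ℕ} (s : ℝ) (p : Phase d) : Phase d := (p.1 + proj (s • p.2), p.2)

/-- `(1/T) ∫₀ᵀ a(φ_s(x, ξ)) ds`. -/
def finiteTimeAverage {d : ℕ} (a : Phase d → ℂ) (T : ℝ) (p : Phase d) : ℂ :=
  (T : ℂ)⁻¹ * ∫ s in (0 : ℝ)..T, a (geodesicFlow s p)

/-- The average `⟨a⟩` of `a` along the geodesic flow. -/
def geodesicAverage {d : ℕ} (a : Phase d → ℂ) (p : Phase d) : ℂ :=
  limUnder atTop (fun T : ℝ => finiteTimeAverage a T p)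

/-- The set `Ω` of resonant frequencies. -/
def resonantSet (d : ℕ) : Set (Euc d) :=
  {ξ | ∃ k : Fin d → ℤ, k ≠ 0 ∧ ∑ i, (k i : ℝ) * ξ i = 0}

end TorusSemiclassical

end

/-! Everything is computed mode by mode in Fourier series. The Weyl operator of `e^{ij·x} b(ξ)`
sends `e^{ik·x}` to `b(h(k + j/2)) e^{i(k+j)·x}`, so the Wigner distribution is `(2π)ᵈ ∑ₖ b(h(k +
j/2)) û(k) conj û(k + j)` (`hasSum_wigner_modeSymbol`). Since `(|k+j|² - |k|²)/2 = j·(k + j/2)`, the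
Schrödinger group multiplies each term by exactly `e^{iαt j·ξ}` with `ξ = h(k + j/2)`. There is no
remainder, hence no restriction on `α`. Averaging against `φ` turns this phase into the Fourier
integral of `φ` at `α j·ξ`.

For `j = 0` nothing moves. For `j ≠ 0` the frequencies with `|j·ξ| > δ` are killed by the
Riemann-Lebesgue lemma as `α → ∞`, and those with `|j·ξ| ≤ δ` carry a mass controlled by what `μ₀`
gives to a neighbourhood of the hyperplane `j·ξ = 0`, which is small because `μ₀` does not charge
`𝕋ᵈ × Ω` (`tendsto_integral_wigner_modeSymbol`). So at almost every time only the zero mode in `x`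
survives, and `μ t` is the normalized Haar measure times the `ξ`-projection of `μ₀` (`ae_eq_prod`).

On the other side, trigonometric polynomials show that `⟨a⟩` exists everywhere and, off `Ω`, is the
mean of `a` over the fibre (Kronecker-Weyl, `tendsto_lineAverage_of_notMem_resonantSet`). Fubini
then identifies the two integrals. -/

namespace TorusSemiclassical

/-! ### Fourier series on the torus and functions of the Laplacian. -/

section PlaneWaves

open Submodule
open scoped Pointwise

variable {d : ℕ}

theorem planeWave_apply (k : Fin d → ℤ) (x : Torus d) :
    planeWave k x = ∏ i, fourier (k i) (x i) := rfl

theorem planeWave_zero : planeWave (0 : Fin d → ℤ) = 1 := by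
  ext x; simp [planeWave_apply]

theorem planeWave_add_index (j k : Fin d → ℤ) (x : Torus d) :
    planeWave (j + k) x = planeWave j x * planeWave k x := by
  simp only [planeWave_apply, Pi.add_apply, fourier_add, Finset.prod_mul_distrib]

theorem planeWave_neg_index (k : Fin d → ℤ) (x : Torus d) :
    planeWave (-k) x = starRingEnd ℂ (planeWave k x) := by
  simp only [planeWave_apply, Pi.neg_apply, fourier_neg, map_prod]

theorem planeWave_add (k : Fin d → ℤ) (x y : Torus d) :
    planeWave k (x + y) = planeWave k x * planeWave k y := by
  simp only [planeWave_apply, fourier_apply, Pi.add_apply, smul_add, AddCircle.toCircle_add,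
    Circle.coe_mul, Finset.prod_mul_distrib]

@[simp] theorem norm_planeWave (k : Fin d → ℤ) (x : Torus d) : ‖planeWave k x‖ = 1 := by
  simp only [planeWave_apply, fourier_apply, norm_prod, Circle.norm_coe, Finset.prod_const_one]

theorem planeWave_proj (k : Fin d → ℤ) (x : Euc d) :
    planeWave k (proj x) = Complex.exp (Complex.I * (∑ i, (k i : ℝ) * x i : ℝ)) := by
  simp only [planeWave_apply, proj, fourier_coe_apply]
  rw [← Complex.exp_sum]
  congr 1
  push_cast
  rw [Finset.mul_sum]
  refine Finset.sum_congr rfl fun i _ => ?_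
  have : (π : ℂ) ≠ 0 := by exact_mod_cast Real.pi_ne_zero
  field_simp

theorem planeWave_single [DecidableEq (Fin d)] (x : Torus d) (i : Fin d) :
    planeWave (Pi.single i 1) x = fourier 1 (x i) := by
  rw [planeWave_apply, Finset.prod_eq_single i]
  · simp
  · intro j _ hj; simp [Pi.single_eq_of_ne hj]
  · simp

/-- The star subalgebra of `C(𝕋ᵈ, ℂ)` generated by the plane waves. -/
noncomputable def planeWaveSubalgebra (d : ℕ) : StarSubalgebra ℂ C(Torus d, ℂ) where
  toSubalgebra := Algebra.adjoin ℂ (Set.range planeWave)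
  star_mem' := by
    change Algebra.adjoin ℂ (Set.range planeWave) ≤ star (Algebra.adjoin ℂ (Set.range planeWave))
    refine Algebra.adjoin_le ?_
    rintro _ ⟨n, rfl⟩
    refine Algebra.subset_adjoin ⟨-n, ?_⟩
    ext1 x
    simp only [planeWave_neg_index, starRingEnd_apply, ContinuousMap.star_apply]

theorem planeWaveSubalgebra_coe :
    Subalgebra.toSubmodule (planeWaveSubalgebra d).toSubalgebra
      = span ℂ (Set.range planeWave) := by
  apply Algebra.adjoin_eq_span_of_subset
  refine .trans (fun x ↦ Submonoid.closure_induction (fun _ ↦ id) ⟨0, planeWave_zero⟩ ?_)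
    subset_span
  rintro _ _ _ _ ⟨m, rfl⟩ ⟨n, rfl⟩
  exact ⟨m + n, by ext z; simp [planeWave_add_index]⟩

theorem planeWaveSubalgebra_separatesPoints : (planeWaveSubalgebra d).SeparatesPoints := by
  classical
  intro x y hxy
  rw [Ne, funext_iff, not_forall] at hxy
  obtain ⟨i, hi⟩ := hxy
  refine ⟨_, ⟨planeWave (Pi.single i 1), Algebra.subset_adjoin ⟨Pi.single i 1, rfl⟩, rfl⟩, ?_⟩
  dsimp only
  rw [planeWave_single, planeWave_single, fourier_one, fourier_one]
  exact fun h => hi (AddCircle.injective_toCircle Real.two_pi_pos.ne' (Circle.ext h))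

/-- Trigonometric polynomials are dense in `C(𝕋ᵈ, ℂ)`. -/
theorem span_planeWave_closure_eq_top :
    (span ℂ (Set.range <| planeWave (d := d))).topologicalClosure = ⊤ := by
  rw [← planeWaveSubalgebra_coe]
  exact congr_arg (Subalgebra.toSubmodule <| StarSubalgebra.toSubalgebra ·)
    (ContinuousMap.starSubalgebra_topologicalClosure_eq_top_of_separatesPoints _
      planeWaveSubalgebra_separatesPoints)

theorem mem_closure_span_planeWave (f : C(Torus d, ℂ)) :
    f ∈ closure (span ℂ (Set.range (planeWave (d := d))) : Set C(Torus d, ℂ)) := by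
  rw [← Submodule.topologicalClosure_coe, span_planeWave_closure_eq_top]
  trivial

theorem measureReal_univ_torus : (volume : Measure (Torus d)).real Set.univ = (2 * π) ^ d := by
  rw [measureReal_def, ← Set.pi_univ, volume_pi, Measure.pi_pi]
  rw [Finset.prod_congr rfl fun i _ => AddCircle.measure_univ (2 * π), Finset.prod_const,
    ENNReal.toReal_pow, ENNReal.toReal_ofReal Real.two_pi_pos.le, Finset.card_univ,
    Fintype.card_fin]

theorem integral_planeWave (k : Fin d → ℤ) :
    ∫ x, planeWave k x = if k = 0 then ((2 * π : ℝ) : ℂ) ^ d else 0 := by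
  classical
  split_ifs with h
  · subst h
    simp only [planeWave_zero, ContinuousMap.one_apply, integral_const, measureReal_univ_torus]
    simp
  · obtain ⟨i, hi⟩ := Function.ne_iff.mp h
    -- Half a period of the wave in the `i`-th variable: translation by `v` changes its sign, so its
    -- integral is its own negative.
    set v : Torus d := Pi.single i ((2 * π / 2 / (k i : ℝ) : ℝ) : AddCircle (2 * π)) with hv
    have h1 : planeWave k v = -1 := by
      rw [planeWave_apply, Finset.prod_eq_single i]
      · have : (k i : ℂ) ≠ 0 := by exact_mod_cast hi
        have h2 : (π : ℂ) ≠ 0 := by exact_mod_cast Real.pi_ne_zero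
        rw [hv, Pi.single_eq_same, fourier_coe_apply, ← Complex.exp_pi_mul_I]
        congr 1
        push_cast
        field_simp
      · intro j _ hj; simp [hv, Pi.single_eq_of_ne hj]
      · simp
    refine integral_eq_zero_of_add_right_eq_neg (g := v) fun x => ?_
    rw [planeWave_add, h1, mul_neg_one]

/-- The normalization `(2π)^{-d/2}` of plane waves in `L²`. -/
noncomputable def planeWaveScale (d : ℕ) : ℂ := ((√((2 * π) ^ d))⁻¹ : ℝ)

theorem planeWaveScale_ne_zero : planeWaveScale d ≠ 0 := by
  have : (0 : ℝ) < (2 * π) ^ d := pow_pos Real.two_pi_pos d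
  rw [planeWaveScale]
  exact_mod_cast (inv_pos.2 (Real.sqrt_pos.2 this)).ne'

theorem planeWaveScale_mul_self :
    planeWaveScale d * planeWaveScale d * ((2 * π : ℝ) : ℂ) ^ d = 1 := by
  have : (0 : ℝ) < (2 * π) ^ d := pow_pos Real.two_pi_pos d
  rw [planeWaveScale, ← Complex.ofReal_pow, ← Complex.ofReal_mul, ← Complex.ofReal_mul,
    ← mul_inv, Real.mul_self_sqrt this.le, inv_mul_cancel₀ this.ne', Complex.ofReal_one]

theorem conj_planeWaveScale : starRingEnd ℂ (planeWaveScale d) = planeWaveScale d := by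
  rw [planeWaveScale, Complex.conj_ofReal]

/-- The normalized plane waves, as elements of `L²(𝕋ᵈ)`. -/
noncomputable def planeWaveUnit (k : Fin d → ℤ) : L2 d :=
  planeWaveScale d • ContinuousMap.toLp 2 volume ℂ (planeWave k)

theorem orthonormal_planeWaveUnit : Orthonormal ℂ (planeWaveUnit (d := d)) := by
  rw [orthonormal_iff_ite]
  intro m n
  simp only [planeWaveUnit, inner_smul_left, inner_smul_right, ContinuousMap.inner_toLp,
    ← planeWave_neg_index, ← planeWave_add_index, integral_planeWave, conj_planeWaveScale]
  by_cases h : m = n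
  · subst h; simpa [mul_assoc] using planeWaveScale_mul_self (d := d)
  · rw [if_neg h, if_neg]
    · simp
    · intro h'; exact h (by
        have := congrArg (· + m) h'
        simpa using this.symm)

theorem span_planeWaveUnit_closure_eq_top :
    (span ℂ (Set.range (planeWaveUnit (d := d)))).topologicalClosure = ⊤ := by
  have h1 : span ℂ (Set.range (planeWaveUnit (d := d)))
      = span ℂ (Set.range fun k => ContinuousMap.toLp 2 volume ℂ (planeWave (d := d) k)) := by
    have : Set.range (planeWaveUnit (d := d)) = (planeWaveScale d) •
        (Set.range fun k => (ContinuousMap.toLp 2 volume ℂ (planeWave (d := d) k) : L2 d)) := by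
      rw [← Set.image_smul, ← Set.range_comp]; rfl
    rw [this]
    exact span_smul_eq_of_isUnit _ _ (IsUnit.mk0 _ planeWaveScale_ne_zero)
  rw [h1]
  simpa only [map_span, ContinuousLinearMap.coe_coe, ← Set.range_comp, Function.comp_def] using
    (ContinuousMap.toLp_denseRange ℂ (volume : Measure (Torus d)) ℂ
      (ENNReal.ofNat_ne_top : (2 : ℝ≥0∞) ≠ ⊤)).topologicalClosure_map_submodule
      span_planeWave_closure_eq_top

/-- The Hilbert basis of `L²(𝕋ᵈ)` of normalized plane waves. -/
noncomputable def planeWaveBasis (d : ℕ) : HilbertBasis (Fin d → ℤ) ℂ (L2 d) :=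
  HilbertBasis.mk orthonormal_planeWaveUnit span_planeWaveUnit_closure_eq_top.ge

theorem coe_planeWaveBasis : ⇑(planeWaveBasis d) = planeWaveUnit := HilbertBasis.coe_mk _ _

theorem inner_toLp_planeWave (k : Fin d → ℤ) (f : L2 d) :
    inner ℂ (ContinuousMap.toLp 2 volume ℂ (planeWave k) : L2 d) f
      = ((2 * π : ℝ) : ℂ) ^ d * coeff f k := by
  have h2 : ((2 * π : ℝ) : ℂ) ≠ 0 := by exact_mod_cast Real.two_pi_pos.ne'
  rw [coeff, ← mul_assoc, ← mul_pow, mul_inv_cancel₀ h2, one_pow, one_mul,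
    MeasureTheory.L2.inner_def]
  apply integral_congr_ae
  filter_upwards [ContinuousMap.coeFn_toLp (p := 2) (𝕜 := ℂ) volume (planeWave k)] with x hx
  rw [hx, RCLike.inner_apply, mul_comm]

theorem planeWaveBasis_repr (f : L2 d) (k : Fin d → ℤ) :
    (planeWaveBasis d).repr f k = planeWaveScale d * ((2 * π : ℝ) : ℂ) ^ d * coeff f k := by
  rw [HilbertBasis.repr_apply_apply, coe_planeWaveBasis, planeWaveUnit, inner_smul_left,
    inner_toLp_planeWave, conj_planeWaveScale, mul_assoc]

theorem coeff_congr_ae {f g : Torus d → ℂ} (h : f =ᵐ[volume] g) (k : Fin d → ℤ) :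
    coeff f k = coeff g k := by
  simp only [coeff]
  congr 1
  apply integral_congr_ae
  filter_upwards [h] with x hx
  rw [hx]

/-- **Parseval's identity**. -/
theorem hasSum_coeff_mul_conj_coeff {f g : Torus d → ℂ} (hf : MemLp f 2) (hg : MemLp g 2) :
    HasSum (fun k => ((2 * π : ℝ) : ℂ) ^ d * (coeff f k * starRingEnd ℂ (coeff g k)))
      (∫ x, f x * starRingEnd ℂ (g x)) := by
  have h := (planeWaveBasis d).hasSum_inner_mul_inner (hg.toLp g) (hf.toLp f)
  have e : inner ℂ (hg.toLp g) (hf.toLp f) = ∫ x, f x * starRingEnd ℂ (g x) := by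
    rw [MeasureTheory.L2.inner_def]
    apply integral_congr_ae
    filter_upwards [hf.coeFn_toLp, hg.coeFn_toLp] with x h1 h2
    rw [h1, h2, RCLike.inner_apply]
  rw [e] at h
  refine h.congr_fun fun k => ?_
  rw [← inner_conj_symm, ← HilbertBasis.repr_apply_apply, ← HilbertBasis.repr_apply_apply,
    planeWaveBasis_repr, planeWaveBasis_repr, coeff_congr_ae hf.coeFn_toLp,
    coeff_congr_ae hg.coeFn_toLp]
  simp only [map_mul, map_pow, Complex.conj_ofReal, conj_planeWaveScale]
  linear_combination (-(((2 * π : ℝ) : ℂ) ^ d * (coeff f k * starRingEnd ℂ (coeff g k))))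
    * planeWaveScale_mul_self (d := d)

theorem summable_norm_coeff_sq {f : Torus d → ℂ} (hf : MemLp f 2) :
    Summable fun k => ‖coeff f k‖ ^ 2 := by
  have h := (hasSum_coeff_mul_conj_coeff hf hf).summable.norm
  have h2 : (2 * π) ^ d ≠ 0 := (pow_pos Real.two_pi_pos d).ne'
  refine (h.mul_left ((2 * π) ^ d)⁻¹).congr fun k => ?_
  rw [norm_mul, norm_pow, norm_mul, Complex.norm_real, RCLike.norm_conj,
    Real.norm_of_nonneg Real.two_pi_pos.le, inv_mul_cancel_left₀ h2, sq]

theorem tsum_norm_coeff_sq (f : L2 d) :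
    (2 * π) ^ d * ∑' k, ‖coeff f k‖ ^ 2 = ‖f‖ ^ 2 := by
  have h := hasSum_coeff_mul_conj_coeff (Lp.memLp f) (Lp.memLp f)
  have e : ∫ x, f x * starRingEnd ℂ (f x) = ((‖f‖ ^ 2 : ℝ) : ℂ) := by
    have := inner_self_eq_norm_sq_to_K (𝕜 := ℂ) f
    rw [MeasureTheory.L2.inner_def] at this
    rw [Complex.ofReal_pow]
    refine Eq.trans ?_ this
    simp only [RCLike.inner_apply]
  rw [e] at h
  have h' : HasSum (fun k => (((2 * π) ^ d * ‖coeff f k‖ ^ 2 : ℝ) : ℂ)) ((‖f‖ ^ 2 : ℝ) : ℂ) := by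
    refine h.congr_fun fun k => ?_
    rw [Complex.mul_conj']; push_cast; ring
  rw [← (Complex.hasSum_ofReal.1 h').tsum_eq, tsum_mul_left]

/-- The Fourier coefficients of `F(Δ) u`. -/
theorem coeff_functionOfLaplacian {F : ℝ → ℂ} {C : ℝ} (hF : ∀ r, ‖F r‖ ≤ C) (u : L2 d)
    (k : Fin d → ℤ) :
    coeff (functionOfLaplacian F u) k = F (-∑ i, (k i : ℝ) ^ 2) * coeff u k := by
  set c : (Fin d → ℤ) → ℂ := fun k => (planeWaveScale d)⁻¹ * (F (-∑ i, (k i : ℝ) ^ 2) * coeff u k)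
    with hc
  -- The bound on `F` makes the coefficients square summable, so the `tsum` in `functionOfLaplacian`
  -- is a convergent series and not the default value 0.
  have hmem : Memℓp c 2 := by
    apply memℓp_gen
    have hs := (summable_norm_coeff_sq (Lp.memLp u)).mul_left (‖(planeWaveScale d)⁻¹‖ ^ 2 * C ^ 2)
    refine Summable.of_nonneg_of_le (fun _ => by positivity) (fun k => ?_) hs
    simp only [hc, norm_mul, ENNReal.toReal_ofNat, Real.rpow_two, mul_pow]
    rw [← mul_assoc]
    have := hF (-∑ i, (k i : ℝ) ^ 2)
    gcongr
  have hsum := (planeWaveBasis d).hasSum_repr_symm ⟨c, hmem⟩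
  have hEq : functionOfLaplacian F u = (planeWaveBasis d).repr.symm ⟨c, hmem⟩ := by
    rw [← hsum.tsum_eq, functionOfLaplacian]
    refine tsum_congr fun k => ?_
    rw [coe_planeWaveBasis, planeWaveUnit, smul_smul]
    congr 1
    simp only [hc]
    rw [mul_comm _ (planeWaveScale d), mul_inv_cancel_left₀ planeWaveScale_ne_zero]
  have hr : (planeWaveBasis d).repr (functionOfLaplacian F u) k = c k := by
    rw [hEq, LinearIsometryEquiv.apply_symm_apply]
  rw [planeWaveBasis_repr] at hr
  have h3 := planeWaveScale_mul_self (d := d)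
  have h4 := congrArg (planeWaveScale d * ·) hr
  simp only [hc] at h4
  rw [mul_inv_cancel_left₀ planeWaveScale_ne_zero] at h4
  rw [← h4]
  linear_combination (-(coeff (functionOfLaplacian F u) k)) * h3

theorem coeff_schrodinger (s : ℝ) (u : L2 d) (k : Fin d → ℤ) :
    coeff (schrodinger s u) k
      = Complex.exp (Complex.I * s * ((-∑ i, (k i : ℝ) ^ 2 : ℝ) : ℂ) / 2) * coeff u k := by
  refine coeff_functionOfLaplacian (C := 1) (fun r => le_of_eq ?_) u k
  have : Complex.I * s * r / 2 = ((s * r / 2 : ℝ) : ℂ) * Complex.I := by push_cast; ring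
  rw [this, Complex.norm_exp_ofReal_mul_I]

end PlaneWaves

/-! ### Wigner distributions of single modes in Fourier variables. -/

section WignerFormula

variable {d : ℕ}

theorem proj_add (x y : Euc d) : proj (x + y) = proj x + proj y := by
  ext i; simp [proj]

theorem proj_sub (x y : Euc d) : proj (x - y) = proj x - proj y := by
  ext i; simp [proj]

theorem continuous_proj : Continuous (proj : Euc d → Torus d) :=
  continuous_pi fun i => (AddCircle.continuous_mk' _).comp (by fun_prop)

/-- Turns the integral over the fundamental domain in `wigner` into one over the torus, where
translation invariance is available. -/
theorem measurePreserving_proj :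
    MeasurePreserving (proj : Euc d → Torus d)
      (volume.restrict {x : Euc d | ∀ i, x i ∈ Set.Ico 0 (2 * π)}) volume := by
  have h1 := (PiLp.volume_preserving_ofLp (Fin d)).restrict_preimage
    (MeasurableSet.univ_pi (fun _ : Fin d => measurableSet_Ico (a := (0 : ℝ)) (b := 2 * π)))
  have h2 : MeasurePreserving (QuotientAddGroup.mk : ℝ → AddCircle (2 * π))
      (volume.restrict (Set.Ico 0 (2 * π))) volume := by
    have := AddCircle.measurePreserving_mk (2 * π) 0
    rw [zero_add] at this
    rwa [Measure.restrict_congr_set Ico_ae_eq_Ioc]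
  have h3 := measurePreserving_pi
    (fun _ : Fin d => (volume : Measure ℝ).restrict (Set.Ico 0 (2 * π)))
    (fun _ => (volume : Measure (AddCircle (2 * π)))) (fun _ => h2)
  rw [← Measure.restrict_pi_pi] at h3
  have h4 := h3.comp h1
  have e : {x : Euc d | ∀ i, x i ∈ Set.Ico 0 (2 * π)}
      = WithLp.ofLp ⁻¹' (Set.univ.pi fun _ : Fin d => Set.Ico 0 (2 * π)) := by
    ext x; simp
  rw [e]
  exact h4

/-- The symbol `e^{ij·x} b(ξ)`. -/
noncomputable def modeSymbol (j : Fin d → ℤ) (b : Euc d → ℂ) (p : Phase d) : ℂ :=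
  planeWave j p.1 * b p.2

theorem contDiff_planeWave_proj (j : Fin d → ℤ) :
    ContDiff ℝ ∞ fun x : Euc d => planeWave j (proj x) := by
  simp_rw [planeWave_proj]
  have h : ContDiff ℝ ∞ fun x : Euc d => ∑ i, (j i : ℝ) * x i :=
    ContDiff.sum fun i _ => contDiff_const.mul (by fun_prop)
  exact (contDiff_const.mul (Complex.ofRealCLM.contDiff.comp h)).cexp

theorem isSymbol_modeSymbol (j : Fin d → ℤ) {b : Euc d → ℂ} (hb : ContDiff ℝ ∞ b)
    (hc : HasCompactSupport b) : IsSymbol (modeSymbol j b) := by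
  refine ⟨?_, ?_⟩
  · exact ((contDiff_planeWave_proj j).comp contDiff_fst).mul (hb.comp contDiff_snd)
  · refine HasCompactSupport.intro (isCompact_univ.prod hc) fun p hp => ?_
    have : p.2 ∉ tsupport b := fun h => hp ⟨Set.mem_univ _, h⟩
    rw [modeSymbol, image_eq_zero_of_notMem_tsupport this, mul_zero]

/-- The profile of the convolution kernel of the Weyl quantization of `b(ξ)`. -/
noncomputable def convProfile (h : ℝ) (b : Euc d → ℂ) (z : Euc d) : ℂ :=
  ((2 * π : ℝ) : ℂ)⁻¹ ^ d *
    ∫ ξ : Euc d, b (h • ξ) * Complex.exp (Complex.I * (inner ℝ z ξ : ℝ))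

open scoped FourierTransform in
theorem convProfile_eq_fourierInv (h : ℝ) (b : Euc d → ℂ) (z : Euc d) :
    convProfile h b z = ((2 * π : ℝ) : ℂ)⁻¹ ^ d * 𝓕⁻ (fun ξ => b (h • ξ)) ((2 * π)⁻¹ • z) := by
  rw [convProfile, Real.fourierInv_eq']
  congr 1
  refine integral_congr_ae (Eventually.of_forall fun ξ => ?_)
  simp only
  rw [smul_eq_mul, mul_comm, real_inner_smul_right, real_inner_comm,
    mul_inv_cancel_left₀ Real.two_pi_pos.ne', mul_comm Complex.I]

theorem hasCompactSupport_dilation {h : ℝ} (hh : h ≠ 0) {b : Euc d → ℂ}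
    (hc : HasCompactSupport b) : HasCompactSupport fun ξ => b (h • ξ) :=
  hc.comp_homeomorph (Homeomorph.smulOfNeZero h hh)

-- A dilate of `b` is a Schwartz function, hence so is its inverse Fourier transform. The condition
-- `h ≠ 0` keeps the support of the dilate compact.
open scoped FourierTransform in
theorem integrable_convProfile {h : ℝ} (hh : h ≠ 0) {b : Euc d → ℂ} (hb : ContDiff ℝ ∞ b)
    (hc : HasCompactSupport b) :
    Integrable (convProfile h b) ∧ Continuous (convProfile h b) := by
  set B : SchwartzMap (Euc d) ℂ :=
    (hasCompactSupport_dilation hh hc).toSchwartzMap (hb.comp (contDiff_const_smul h)) with hB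
  have hBc : (B : Euc d → ℂ) = fun ξ => b (h • ξ) := rfl
  have e : convProfile h b = fun z => ((2 * π : ℝ) : ℂ)⁻¹ ^ d * (𝓕⁻ B) ((2 * π)⁻¹ • z) := by
    ext z
    rw [convProfile_eq_fourierInv, SchwartzMap.fourierInv_coe, hBc]
  rw [e]
  constructor
  · exact (((𝓕⁻ B).integrable (μ := volume)).comp_smul
      (inv_ne_zero Real.two_pi_pos.ne')).const_mul _
  · exact continuous_const.mul ((𝓕⁻ B).continuous.comp (continuous_const_smul _))

-- Fourier inversion; the Jacobian `(2π)ᵈ` of `z ↦ z/(2π)` cancels the normalization of the kernel.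
open scoped FourierTransform in
theorem integral_convProfile_mul_exp {h : ℝ} (hh : h ≠ 0) {b : Euc d → ℂ} (hb : ContDiff ℝ ∞ b)
    (hc : HasCompactSupport b) (η : Euc d) :
    ∫ z, convProfile h b z * Complex.exp (-(Complex.I * (inner ℝ z η : ℝ))) = b (h • η) := by
  set B : SchwartzMap (Euc d) ℂ :=
    (hasCompactSupport_dilation hh hc).toSchwartzMap (hb.comp (contDiff_const_smul h)) with hB
  have hBc : (B : Euc d → ℂ) = fun ξ => b (h • ξ) := rfl
  have h2 : ((2 * π : ℝ) : ℂ) ≠ 0 := by exact_mod_cast Real.two_pi_pos.ne'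
  obtain ⟨g, hg⟩ : ∃ g : Euc d → ℂ, g = fun w =>
      Complex.exp (↑(-2 * π * inner ℝ w η) * Complex.I) • (𝓕⁻ B) w := ⟨_, rfl⟩
  have e : ∀ z, convProfile h b z * Complex.exp (-(Complex.I * (inner ℝ z η : ℝ)))
      = ((2 * π : ℝ) : ℂ)⁻¹ ^ d * g ((2 * π)⁻¹ • z) := by
    intro z
    rw [hg]
    rw [convProfile_eq_fourierInv, ← hBc, ← SchwartzMap.fourierInv_coe]
    simp only [smul_eq_mul, real_inner_smul_left]
    have : -2 * π * ((2 * π)⁻¹ * inner ℝ z η) = - inner ℝ z η := by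
      field_simp
    rw [this, Complex.ofReal_neg, neg_mul, mul_comm Complex.I]
    ring
  rw [integral_congr_ae (Eventually.of_forall e), integral_const_mul,
    Measure.integral_comp_inv_smul volume g (2 * π), hg, ← Real.fourier_eq',
    ← SchwartzMap.fourier_coe, FourierTransform.fourier_fourierInv_eq, hBc, finrank_euclideanSpace,
    Fintype.card_fin, abs_of_nonneg (pow_nonneg Real.two_pi_pos.le d), Complex.real_smul,
    Complex.ofReal_pow, ← mul_assoc, ← mul_pow, inv_mul_cancel₀ h2, one_pow, one_mul]

/-- The frequency `h (k + j/2)`. -/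
noncomputable def midFreq (h : ℝ) (j k : Fin d → ℤ) : Euc d :=
  WithLp.toLp 2 fun i => h * ((k i : ℝ) + (j i : ℝ) / 2)

/-- The convolution kernel of the Weyl quantization of `e^{ij·x} b(ξ)`. -/
noncomputable def modeKernel (h : ℝ) (j : Fin d → ℤ) (b : Euc d → ℂ) (z : Euc d) : ℂ :=
  planeWave j (proj (-((2 : ℝ)⁻¹ • z))) * convProfile h b z

theorem integrable_modeKernel {h : ℝ} (hh : h ≠ 0) (j : Fin d → ℤ) {b : Euc d → ℂ}
    (hb : ContDiff ℝ ∞ b) (hc : HasCompactSupport b) :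
    Integrable (modeKernel h j b) ∧ Continuous (modeKernel h j b) := by
  obtain ⟨h1, h2⟩ := integrable_convProfile hh hb hc
  have h3 : Continuous fun z : Euc d => planeWave j (proj (-((2 : ℝ)⁻¹ • z))) :=
    (planeWave j).continuous.comp (continuous_proj.comp (by fun_prop))
  exact ⟨h1.bdd_mul (c := 1) h3.aestronglyMeasurable (Eventually.of_forall fun z => by simp),
    h3.mul h2⟩

/-- The half phase `e^{-ij·z/2}`, a trace of the midpoint `(x+y)/2`, shifts the frequency at which
`b` is read from `k` to `k + j/2`. -/
theorem integral_modeKernel_mul_conj {h : ℝ} (hh : h ≠ 0) (j k : Fin d → ℤ) {b : Euc d → ℂ}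
    (hb : ContDiff ℝ ∞ b) (hc : HasCompactSupport b) :
    ∫ z, modeKernel h j b z * starRingEnd ℂ (planeWave k (proj z)) = b (midFreq h j k) := by
  have e : midFreq h j k = h • (WithLp.toLp 2 fun i => (k i : ℝ) + (j i : ℝ) / 2 : Euc d) := by
    ext i; simp [midFreq]
  rw [e, ← integral_convProfile_mul_exp hh hb hc]
  refine integral_congr_ae (Eventually.of_forall fun z => ?_)
  simp only [modeKernel]
  rw [← planeWave_neg_index, planeWave_proj, planeWave_proj, mul_right_comm, ← Complex.exp_add,
    mul_comm]
  congr 2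
  rw [← mul_add, ← mul_neg, ← Complex.ofReal_add, ← Complex.ofReal_neg]
  congr 2
  rw [PiLp.inner_apply, ← Finset.sum_add_distrib, ← Finset.sum_neg_distrib]
  refine Finset.sum_congr rfl fun i _ => ?_
  simp
  ring

/-- With `y = x - z` the midpoint is `x - z/2`, so the wave splits off the factor `e^{ij·x}` and the
rest is a convolution. -/
theorem weylOp_modeSymbol (h : ℝ) (j : Fin d → ℤ) (b : Euc d → ℂ) (u : Torus d → ℂ) (x : Euc d) :
    weylOp h (modeSymbol j b) u x
      = planeWave j (proj x) * ∫ z, modeKernel h j b z * u (proj x - proj z) := by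
  rw [weylOp, ← integral_sub_left_eq_self _ volume x, ← integral_const_mul]
  refine integral_congr_ae (Eventually.of_forall fun z => ?_)
  simp only
  rw [← proj_sub, ← mul_assoc]
  congr 1
  have e : (2 : ℝ)⁻¹ • (x + (x - z)) = x + -((2 : ℝ)⁻¹ • z) := by module
  rw [weylKernel, e, sub_sub_cancel]
  simp only [modeSymbol, modeKernel, convProfile, mul_assoc]
  rw [integral_const_mul, proj_add, planeWave_add]
  ring

theorem coeff_translate (u : Torus d → ℂ) (y : Torus d) (k : Fin d → ℤ) :
    coeff (fun x => u (x - y)) k = starRingEnd ℂ (planeWave k y) * coeff u k := by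
  rw [coeff, coeff,
    ← integral_add_right_eq_self (fun x => starRingEnd ℂ (planeWave k x) * u (x - y)) y,
    mul_left_comm]
  congr 1
  rw [← integral_const_mul]
  refine integral_congr_ae (Eventually.of_forall fun x => ?_)
  simp only [add_sub_cancel_right, planeWave_add, map_mul]
  ring

theorem coeff_conj_planeWave_mul (u : Torus d → ℂ) (j k : Fin d → ℤ) :
    coeff (fun x => starRingEnd ℂ (planeWave j x) * u x) k = coeff u (k + j) := by
  rw [coeff, coeff]
  congr 1
  refine integral_congr_ae (Eventually.of_forall fun x => ?_)
  simp only [planeWave_add_index, map_mul, mul_assoc]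

theorem memLp_translate (u : L2 d) (y : Torus d) : MemLp (fun x => u (x - y)) 2 :=
  (Lp.memLp u).comp_measurePreserving (measurePreserving_sub_right volume y)

theorem memLp_conj_planeWave_mul (u : L2 d) (j : Fin d → ℤ) :
    MemLp (fun x => starRingEnd ℂ (planeWave j x) * u x) 2 := by
  refine (Lp.memLp u).of_le ?_ (Eventually.of_forall fun x => by simp)
  exact (Complex.continuous_conj.comp (planeWave j).continuous).aestronglyMeasurable.mul
    (Lp.aestronglyMeasurable u)

/-- Parseval for the pair `u(· - y)` and `e^{-ij·x} u`: translation gives a phase, modulation a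
shift of index. -/
theorem hasSum_correlation (u : L2 d) (j : Fin d → ℤ) (y : Torus d) :
    HasSum (fun k => ((2 * π : ℝ) : ℂ) ^ d * (starRingEnd ℂ (planeWave k y) *
        (coeff u k * starRingEnd ℂ (coeff u (k + j)))))
      (∫ x, planeWave j x * u (x - y) * starRingEnd ℂ (u x)) := by
  have h := hasSum_coeff_mul_conj_coeff (memLp_translate u y) (memLp_conj_planeWave_mul u j)
  have e : (∫ x, u (x - y) * starRingEnd ℂ (starRingEnd ℂ (planeWave j x) * u x))
      = ∫ x, planeWave j x * u (x - y) * starRingEnd ℂ (u x) := by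
    refine integral_congr_ae (Eventually.of_forall fun x => ?_)
    simp only [map_mul, Complex.conj_conj]
    ring
  rw [e] at h
  refine h.congr_fun fun k => ?_
  rw [coeff_translate, coeff_conj_planeWave_mul, mul_assoc]

theorem summable_norm_coeff_mul (u : L2 d) (j : Fin d → ℤ) :
    Summable fun k => ‖coeff u k‖ * ‖coeff u (k + j)‖ := by
  have h1 := summable_norm_coeff_sq (Lp.memLp u)
  have h2 : Summable fun k => ‖coeff u (k + j)‖ ^ 2 :=
    h1.comp_injective (add_left_injective j)
  refine Summable.of_nonneg_of_le (fun _ => mul_nonneg (norm_nonneg _) (norm_nonneg _))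
    (fun k => ?_) (h1.add h2)
  have := two_mul_le_add_sq ‖coeff u k‖ ‖coeff u (k + j)‖
  have := mul_nonneg (norm_nonneg (coeff u k)) (norm_nonneg (coeff u (k + j)))
  linarith

theorem stronglyMeasurable_translate (u : L2 d) :
    StronglyMeasurable fun p : Torus d × Euc d => u (p.1 - proj p.2) :=
  (Lp.stronglyMeasurable u).comp_measurable
    (measurable_fst.sub (continuous_proj.measurable.comp measurable_snd))

/-- The Fubini hypothesis for `hasSum_wigner_modeSymbol`. The product `|u(x)| |u(x - z)|` is
dominated by the sum of the two squares, and the second square reduces to a product function by a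
measure preserving shear. -/
theorem integrable_correlation (u : L2 d) (j : Fin d → ℤ) {K : Euc d → ℂ} (hK : Integrable K)
    (hKc : Continuous K) :
    Integrable (fun p : Torus d × Euc d =>
      planeWave j p.1 * (K p.2 * u (p.1 - proj p.2)) * starRingEnd ℂ (u p.1))
      (volume.prod volume) := by
  have hm : StronglyMeasurable (fun p : Torus d × Euc d =>
      planeWave j p.1 * (K p.2 * u (p.1 - proj p.2)) * starRingEnd ℂ (u p.1)) := by
    refine StronglyMeasurable.mul (StronglyMeasurable.mul ?_ (StronglyMeasurable.mul ?_ ?_)) ?_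
    · exact ((planeWave j).continuous.comp continuous_fst).stronglyMeasurable
    · exact (hKc.comp continuous_snd).stronglyMeasurable
    · exact stronglyMeasurable_translate u
    · exact Complex.continuous_conj.comp_stronglyMeasurable
        ((Lp.stronglyMeasurable u).comp_measurable measurable_fst)
  have hu : Integrable fun x => ‖u x‖ ^ 2 := (Lp.memLp u).integrable_norm_pow (by norm_num)
  have h1 : Integrable (fun p : Torus d × Euc d => ‖u p.1‖ ^ 2 * ‖K p.2‖) (volume.prod volume) :=
    hu.mul_prod hK.norm
  have hmp : MeasurePreserving (fun p : Euc d × Torus d => (p.1, p.2 - proj p.1))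
      (volume.prod volume) (volume.prod volume) := by
    refine MeasurePreserving.skew_product (f := id) (g := fun z x => x - proj z)
      (MeasurePreserving.id volume) ?_ (Eventually.of_forall fun z => ?_)
    · exact measurable_snd.sub (continuous_proj.measurable.comp measurable_fst)
    · exact (measurePreserving_sub_right volume (proj z)).map_eq
  have h2 : Integrable (fun p : Torus d × Euc d => ‖K p.2‖ * ‖u (p.1 - proj p.2)‖ ^ 2)
      (volume.prod volume) :=
    (hmp.integrable_comp_of_integrable (hK.norm.mul_prod hu)).swap
  refine (h1.add h2).mono' hm.aestronglyMeasurable (Eventually.of_forall fun p => ?_)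
  simp only [norm_mul, norm_planeWave, one_mul, RCLike.norm_conj, Pi.add_apply]
  nlinarith [mul_nonneg (norm_nonneg (K p.2)) (sq_nonneg (‖u p.1‖ - ‖u (p.1 - proj p.2)‖)),
    mul_nonneg (norm_nonneg (K p.2)) (sq_nonneg (‖u p.1‖)),
    mul_nonneg (norm_nonneg (K p.2)) (sq_nonneg (‖u (p.1 - proj p.2)‖))]

/-- The Wigner distribution tested against `e^{ij·x} b(ξ)`, in Fourier variables. -/
theorem hasSum_wigner_modeSymbol {h : ℝ} (hh : h ≠ 0) (u : L2 d) (j : Fin d → ℤ) {b : Euc d → ℂ}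
    (hb : ContDiff ℝ ∞ b) (hc : HasCompactSupport b) :
    HasSum (fun k => ((2 * π : ℝ) : ℂ) ^ d * (b (midFreq h j k) *
        (coeff u k * starRingEnd ℂ (coeff u (k + j)))))
      (wigner h u (modeSymbol j b)) := by
  obtain ⟨hK, hKc⟩ := integrable_modeKernel hh j hb hc
  set K := modeKernel h j b
  set f : Torus d → Euc d → ℂ := fun x z =>
    planeWave j x * (K z * u (x - proj z)) * starRingEnd ℂ (u x) with hf
  have hint := integrable_correlation u j hK hKc
  have e1 : wigner h u (modeSymbol j b) = ∫ x : Torus d, ∫ z, f x z := by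
    rw [← measurePreserving_proj.map_eq, integral_map continuous_proj.aemeasurable, wigner]
    · refine integral_congr_ae (Eventually.of_forall fun x => ?_)
      simp only [hf, weylOp_modeSymbol]
      rw [integral_mul_const, integral_const_mul]
    · rw [measurePreserving_proj.map_eq]
      exact hint.integral_prod_left.aestronglyMeasurable
  have e2 : wigner h u (modeSymbol j b) = ∫ z, K z *
      ∫ x, planeWave j x * u (x - proj z) * starRingEnd ℂ (u x) := by
    rw [e1, integral_integral_swap hint]
    refine integral_congr_ae (Eventually.of_forall fun z => ?_)
    simp only [hf]
    rw [← integral_const_mul]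
    refine integral_congr_ae (Eventually.of_forall fun x => ?_)
    simp only
    ring
  -- The Fourier series of the correlation is integrated term by term against `K`, which is
  -- justified by absolute summability of `û(k) û(k + j)`.
  set F : (Fin d → ℤ) → Euc d → ℂ := fun k z => (K z * starRingEnd ℂ (planeWave k (proj z))) *
    (((2 * π : ℝ) : ℂ) ^ d * (coeff u k * starRingEnd ℂ (coeff u (k + j)))) with hF
  have hFi : ∀ k, Integrable (F k) := fun k => by
    refine Integrable.mul_const ?_ _
    refine hK.mul_bdd (c := 1) ?_ (Eventually.of_forall fun z => by simp)
    exact (Complex.continuous_conj.comp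
      ((planeWave k).continuous.comp continuous_proj)).aestronglyMeasurable
  have hFn : ∀ k, ∫ z, ‖F k z‖
      = ((∫ z, ‖K z‖) * ‖((2 * π : ℝ) : ℂ) ^ d‖) * (‖coeff u k‖ * ‖coeff u (k + j)‖) := by
    intro k
    rw [mul_assoc, ← integral_mul_const]
    refine integral_congr_ae (Eventually.of_forall fun z => ?_)
    simp only [hF]
    rw [norm_mul, norm_mul, RCLike.norm_conj, norm_planeWave, mul_one, norm_mul, norm_mul,
      RCLike.norm_conj]
  have hsum := hasSum_integral_of_summable_integral_norm hFi
    (by simp_rw [hFn]; exact (summable_norm_coeff_mul u j).mul_left _)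
  have e3 : (∫ z, ∑' k, F k z) = wigner h u (modeSymbol j b) := by
    rw [e2]
    refine integral_congr_ae (Eventually.of_forall fun z => ?_)
    simp only
    rw [← (hasSum_correlation u j (proj z)).tsum_eq, ← tsum_mul_left]
    refine tsum_congr fun k => ?_
    simp only [hF]
    ring
  rw [e3] at hsum
  refine hsum.congr_fun fun k => ?_
  simp only [hF]
  rw [integral_mul_const, integral_modeKernel_mul_conj hh j k hb hc]
  ring

end WignerFormula

/-! ### Time averages of the evolved modes. -/

section Evolution

variable {d : ℕ}

/-- The pairing `j · ξ`. -/
def pairing (j : Fin d → ℤ) (ξ : Euc d) : ℝ := ∑ i, (j i : ℝ) * ξ i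

theorem contDiff_pairing (j : Fin d → ℤ) : ContDiff ℝ ∞ (pairing j) :=
  ContDiff.sum fun i _ => contDiff_const.mul (by fun_prop)

theorem pairing_zero (ξ : Euc d) : pairing 0 ξ = 0 := by simp [pairing]

/-- Half the difference of eigenvalues, `(|k+j|² - |k|²)/2`, equals `j·(k + j/2)`: the phase depends
on the same midpoint frequency at which the Weyl calculus evaluates `b`. -/
theorem coeff_schrodinger_mul_conj (α h t : ℝ) (u : L2 d) (j k : Fin d → ℤ) :
    coeff (schrodinger (α * h * t) u) k
        * starRingEnd ℂ (coeff (schrodinger (α * h * t) u) (k + j))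
      = Complex.exp (Complex.I * ((α * pairing j (midFreq h j k) * t : ℝ) : ℂ))
        * (coeff u k * starRingEnd ℂ (coeff u (k + j))) := by
  rw [coeff_schrodinger, coeff_schrodinger, map_mul, ← Complex.exp_conj, mul_mul_mul_comm,
    ← Complex.exp_add]
  congr 2
  simp only [map_div₀, map_mul, Complex.conj_I, Complex.conj_ofReal, map_ofNat]
  have : α * pairing j (midFreq h j k) * t = (α * h * t) *
      ((∑ i, ((k + j) i : ℝ) ^ 2 - ∑ i, (k i : ℝ) ^ 2) / 2) := by
    have : pairing j (midFreq h j k)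
        = h * ((∑ i, ((k + j) i : ℝ) ^ 2 - ∑ i, (k i : ℝ) ^ 2) / 2) := by
      rw [pairing, ← Finset.sum_sub_distrib, Finset.sum_div, Finset.mul_sum]
      refine Finset.sum_congr rfl fun i _ => ?_
      simp only [midFreq, Pi.add_apply]
      push_cast
      ring
    rw [this]; ring
  rw [this]
  push_cast
  ring

/-- The Fourier integral `∫ φ(t) e^{ist} dt`. -/
noncomputable def fourierIntegral (φ : ℝ → ℂ) (s : ℝ) : ℂ :=
  ∫ t, φ t * Complex.exp (Complex.I * ((s * t : ℝ) : ℂ))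

theorem norm_exp_I_mul (s : ℝ) : ‖Complex.exp (Complex.I * (s : ℂ))‖ = 1 := by
  rw [mul_comm, Complex.norm_exp_ofReal_mul_I]

theorem norm_fourierIntegral_le (φ : ℝ → ℂ) (s : ℝ) :
    ‖fourierIntegral φ s‖ ≤ ∫ t, ‖φ t‖ := by
  refine (norm_integral_le_integral_norm _).trans_eq ?_
  simp_rw [norm_mul, norm_exp_I_mul, mul_one]

theorem fourierIntegral_zero (φ : ℝ → ℂ) : fourierIntegral φ 0 = ∫ t, φ t := by
  simp [fourierIntegral]

/-- The Riemann-Lebesgue lemma. -/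
theorem exists_norm_fourierIntegral_le (φ : ℝ → ℂ) {ε : ℝ} (hε : 0 < ε) :
    ∃ S : ℝ, ∀ s, S ≤ |s| → ‖fourierIntegral φ s‖ ≤ ε := by
  -- No integrability is asked of `φ`: otherwise all these integrals are 0 by default. The rescaling
  -- in `h2` converts `e^{-2πi}` to `e^{i}` conventions.
  have h := Real.tendsto_integral_exp_smul_cocompact φ
  have h2 : Tendsto (fun s : ℝ => s * (-(2 * π)⁻¹)) (cocompact ℝ) (cocompact ℝ) :=
    tendsto_cocompact_mul_right₀ (neg_ne_zero.2 (inv_ne_zero Real.two_pi_pos.ne'))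
  have h3 := (h.comp h2).norm
  rw [norm_zero] at h3
  have h4 := h3.eventually (ge_mem_nhds hε)
  rw [← Metric.cobounded_eq_cocompact, ← comap_norm_atTop, eventually_comap] at h4
  obtain ⟨S, hS⟩ := eventually_atTop.1 h4
  refine ⟨S, fun s hs => ?_⟩
  refine le_trans (le_of_eq ?_) (hS |s| hs s rfl)
  simp only [Function.comp_apply, fourierIntegral]
  congr 1
  refine integral_congr_ae (Eventually.of_forall fun t => ?_)
  simp only
  rw [Circle.smul_def, smul_eq_mul, Real.fourierChar_apply, mul_comm]
  congr 2
  have : 2 * π * -(t * (s * -(2 * π)⁻¹)) = s * t := by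
    field_simp
  rw [this, mul_comm]

/-- The time averaged Wigner distribution of an evolved state, tested against `e^{ij·x} b(ξ)`. -/
theorem hasSum_integral_wigner {h : ℝ} (hh : h ≠ 0) (α : ℝ) (u : L2 d) (j : Fin d → ℤ)
    {b : Euc d → ℂ} (hb : ContDiff ℝ ∞ b) (hc : HasCompactSupport b) {φ : ℝ → ℂ}
    (hφ : Integrable φ) :
    HasSum (fun k => ((2 * π : ℝ) : ℂ) ^ d * (b (midFreq h j k) *
        (fourierIntegral φ (α * pairing j (midFreq h j k)) *
          (coeff u k * starRingEnd ℂ (coeff u (k + j))))))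
      (∫ t, φ t * wigner h (schrodinger (α * h * t) u) (modeSymbol j b)) := by
  obtain ⟨M, hM⟩ := hb.continuous.bounded_above_of_compact_support hc
  set F : (Fin d → ℤ) → ℝ → ℂ := fun k t =>
    (φ t * Complex.exp (Complex.I * ((α * pairing j (midFreq h j k) * t : ℝ) : ℂ))) *
    (((2 * π : ℝ) : ℂ) ^ d * (b (midFreq h j k) * (coeff u k * starRingEnd ℂ (coeff u (k + j)))))
    with hF
  have hFi : ∀ k, Integrable (F k) := fun k => by
    refine Integrable.mul_const ?_ _
    refine hφ.mul_bdd (c := 1) (Continuous.aestronglyMeasurable ?_)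
      (Eventually.of_forall fun z => (norm_exp_I_mul _).le)
    fun_prop
  have hFn : ∀ k, ∫ t, ‖F k t‖ ≤ ((∫ t, ‖φ t‖) * (‖((2 * π : ℝ) : ℂ) ^ d‖ * M))
      * (‖coeff u k‖ * ‖coeff u (k + j)‖) := by
    intro k
    rw [mul_assoc, ← integral_mul_const]
    refine integral_mono (hFi k).norm (hφ.norm.mul_const _) fun t => ?_
    simp only [hF]
    rw [norm_mul, norm_mul, norm_exp_I_mul, mul_one, norm_mul, norm_mul (b _), norm_mul (coeff _ _),
      RCLike.norm_conj, mul_assoc (‖((2 * π : ℝ) : ℂ) ^ d‖)]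
    gcongr
    exact hM _
  have hsum := hasSum_integral_of_summable_integral_norm hFi
    (Summable.of_nonneg_of_le (fun k => integral_nonneg fun t => norm_nonneg _) hFn
      ((summable_norm_coeff_mul u j).mul_left _))
  have e : (∫ t, ∑' k, F k t)
      = ∫ t, φ t * wigner h (schrodinger (α * h * t) u) (modeSymbol j b) := by
    refine integral_congr_ae (Eventually.of_forall fun t => ?_)
    simp only
    rw [← (hasSum_wigner_modeSymbol hh _ j hb hc).tsum_eq, ← tsum_mul_left]
    refine tsum_congr fun k => ?_
    rw [coeff_schrodinger_mul_conj]
    simp only [hF]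
    ring
  rw [e] at hsum
  refine hsum.congr_fun fun k => ?_
  simp only [hF]
  rw [integral_mul_const, fourierIntegral]
  ring

/-- For `j = 0` the phase is trivial: functions of `ξ` alone are conserved. -/
theorem integral_wigner_modeSymbol_zero {h : ℝ} (hh : h ≠ 0) (α : ℝ) (u : L2 d)
    {b : Euc d → ℂ} (hb : ContDiff ℝ ∞ b) (hc : HasCompactSupport b) {φ : ℝ → ℂ}
    (hφ : Integrable φ) :
    ∫ t, φ t * wigner h (schrodinger (α * h * t) u) (modeSymbol 0 b)
      = (∫ t, φ t) * wigner h u (modeSymbol 0 b) := by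
  refine (hasSum_integral_wigner hh α u 0 hb hc hφ).unique ?_
  refine ((hasSum_wigner_modeSymbol hh u 0 hb hc).mul_left (∫ t, φ t)).congr_fun fun k => ?_
  rw [pairing_zero, mul_zero, fourierIntegral_zero]
  ring

theorem modeSymbol_zero (b : Euc d → ℂ) (p : Phase d) : modeSymbol 0 b p = b p.2 := by
  simp [modeSymbol, planeWave_zero]

/-- The frequencies `hk` and `h(k+j)` lie within `O(h)` of their midpoint, so a cut-off may be moved
between the three at a uniformly small cost. -/
theorem dist_midFreq_left (h : ℝ) (j k : Fin d → ℤ) :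
    dist (midFreq h j k) (midFreq h 0 k) = |h| * ‖midFreq 1 j 0‖ := by
  have : midFreq h j k - midFreq h 0 k = h • midFreq 1 j 0 := by
    ext i; simp [midFreq]; ring
  rw [dist_eq_norm, this, norm_smul, Real.norm_eq_abs]

theorem dist_midFreq_right (h : ℝ) (j k : Fin d → ℤ) :
    dist (midFreq h j k) (midFreq h 0 (k + j)) = |h| * ‖midFreq 1 j 0‖ := by
  have : midFreq h j k - midFreq h 0 (k + j) = -(h • midFreq 1 j 0) := by
    ext i; simp [midFreq]; ring
  rw [dist_eq_norm, this, norm_neg, norm_smul, Real.norm_eq_abs]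

/-- Correlations of Fourier coefficients at frequencies in the support of a cut-off are controlled
by the mass that the semiclassical measure gives to the cut-off. -/
theorem eventually_tsum_correlation_le {h : ℕ → ℝ} (h_pos : ∀ n, 0 < h n)
    (h_lim : Tendsto h atTop (𝓝 0)) {u : ℕ → L2 d} {C : ℝ} (hC : ∀ n, ‖u n‖ ≤ C)
    {μ₀ : Measure (Phase d)} (hμ₀ : IsSemiclassicalMeasure h u μ₀) (j : Fin d → ℤ)
    {ψ : Euc d → ℝ} (hψ : ContDiff ℝ ∞ ψ) (hψc : HasCompactSupport ψ)
    (hψ0 : ∀ ξ, 0 ≤ ψ ξ) {ε : ℝ} (hε : 0 < ε) :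
    ∀ᶠ n in atTop, (2 * π) ^ d * ∑' k, ψ (midFreq (h n) j k) *
        (‖coeff (u n) k‖ * ‖coeff (u n) (k + j)‖) ≤ ∫ p, ψ p.2 ∂μ₀ + ε := by
  have hcpx : HasCompactSupport fun ξ => (ψ ξ : ℂ) :=
    hψc.comp_left (g := fun r : ℝ => (r : ℂ)) Complex.ofReal_zero
  have hcd : ContDiff ℝ ∞ fun ξ => (ψ ξ : ℂ) := Complex.ofRealCLM.contDiff.comp hψ
  have hlim : Tendsto (fun n => (wigner (h n) (u n) (modeSymbol 0 fun ξ => (ψ ξ : ℂ))).re) atTop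
      (𝓝 (∫ p, ψ p.2 ∂μ₀)) := by
    have := (Complex.continuous_re.tendsto _).comp (hμ₀ _ (isSymbol_modeSymbol 0 hcd hcpx))
    simp_rw [modeSymbol_zero] at this
    have e : (∫ p : Phase d, (ψ p.2 : ℂ) ∂μ₀) = ((∫ p, ψ p.2 ∂μ₀ : ℝ) : ℂ) := integral_ofReal
    rwa [e, Complex.ofReal_re] at this
  -- `ε'` bounds the oscillation of `ψ` between midpoint and endpoints; times the total mass `C ^ 2`
  -- it costs `ε / 2`. The other half pays for the convergence of the Wigner distribution.
  obtain ⟨ε', hε', hεC⟩ : ∃ ε' > 0, ε' * C ^ 2 ≤ ε / 2 := by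
    refine ⟨ε / 2 / (C ^ 2 + 1), by positivity, ?_⟩
    rw [div_mul_eq_mul_div, div_le_iff₀ (by positivity)]
    nlinarith
  obtain ⟨δ, hδ, hδψ⟩ := Metric.uniformContinuous_iff.1
    (hψc.uniformContinuous_of_continuous hψ.continuous) ε' hε'
  have hsmall : Tendsto (fun n => |h n| * ‖midFreq 1 j 0‖) atTop (𝓝 0) := by
    simpa using h_lim.abs.mul_const ‖midFreq 1 j 0‖
  filter_upwards [hsmall.eventually (gt_mem_nhds hδ),
    hlim.eventually (ge_mem_nhds (lt_add_of_pos_right _ (half_pos hε)))] with n hn1 hn2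
  have hW : HasSum (fun k => (2 * π) ^ d * (ψ (midFreq (h n) 0 k) * ‖coeff (u n) k‖ ^ 2))
      (wigner (h n) (u n) (modeSymbol 0 fun ξ => (ψ ξ : ℂ))).re := by
    have := Complex.hasSum_re (hasSum_wigner_modeSymbol (h_pos n).ne' (u n) 0 hcd hcpx)
    refine this.congr_fun fun k => ?_
    rw [add_zero, Complex.mul_conj', ← Complex.ofReal_pow, ← Complex.ofReal_pow,
      ← Complex.ofReal_mul, ← Complex.ofReal_mul, Complex.ofReal_re]
  have hN : HasSum (fun k => (2 * π) ^ d * ‖coeff (u n) k‖ ^ 2) (‖u n‖ ^ 2) := by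
    rw [← tsum_norm_coeff_sq, ← tsum_mul_left]
    exact ((summable_norm_coeff_sq (Lp.memLp (u n))).mul_left _).hasSum
  -- By the arithmetic-geometric inequality the correlation at `k` is at most the mean of `g k` and
  -- `g (k + j)`, and both have the same sum over `k`.
  set g : (Fin d → ℤ) → ℝ := fun k =>
    (2 * π) ^ d * (ψ (midFreq (h n) 0 k) * ‖coeff (u n) k‖ ^ 2)
      + ε' * ((2 * π) ^ d * ‖coeff (u n) k‖ ^ 2) with hg
  have hgs := hW.add (hN.mul_left ε')
  have hgs' := (Equiv.addRight j).hasSum_iff.2 hgs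
  have hboth := (hgs.add hgs').mul_left (1 / 2)
  have hV : (0 : ℝ) < (2 * π) ^ d := pow_pos Real.two_pi_pos d
  have hle : ∀ k, (2 * π) ^ d * (ψ (midFreq (h n) j k) *
      (‖coeff (u n) k‖ * ‖coeff (u n) (k + j)‖)) ≤ 1 / 2 * (g k + g (k + j)) := by
    intro k
    have h1 : ψ (midFreq (h n) j k) ≤ ψ (midFreq (h n) 0 k) + ε' := by
      have := (abs_lt.1 (hδψ ((dist_midFreq_left (h n) j k).trans_lt hn1))).2
      linarith
    have h2 : ψ (midFreq (h n) j k) ≤ ψ (midFreq (h n) 0 (k + j)) + ε' := by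
      have := (abs_lt.1 (hδψ ((dist_midFreq_right (h n) j k).trans_lt hn1))).2
      linarith
    have h3 : ‖coeff (u n) k‖ * ‖coeff (u n) (k + j)‖
        ≤ 1 / 2 * (‖coeff (u n) k‖ ^ 2 + ‖coeff (u n) (k + j)‖ ^ 2) := by
      have := two_mul_le_add_sq ‖coeff (u n) k‖ ‖coeff (u n) (k + j)‖
      linarith
    have e : 1 / 2 * (g k + g (k + j)) = (2 * π) ^ d * (1 / 2 *
        ((ψ (midFreq (h n) 0 k) + ε') * ‖coeff (u n) k‖ ^ 2
          + (ψ (midFreq (h n) 0 (k + j)) + ε') * ‖coeff (u n) (k + j)‖ ^ 2)) := by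
      simp only [hg]; ring
    rw [e]
    refine mul_le_mul_of_nonneg_left ?_ hV.le
    have h4 := mul_le_mul_of_nonneg_left h3 (hψ0 (midFreq (h n) j k))
    have h5 := mul_le_mul_of_nonneg_right h1 (sq_nonneg ‖coeff (u n) k‖)
    have h6 := mul_le_mul_of_nonneg_right h2 (sq_nonneg ‖coeff (u n) (k + j)‖)
    linarith
  rw [← tsum_mul_left]
  have hsum : Summable fun k => (2 * π) ^ d * (ψ (midFreq (h n) j k) *
      (‖coeff (u n) k‖ * ‖coeff (u n) (k + j)‖)) :=
    Summable.of_nonneg_of_le (fun k => mul_nonneg hV.le (mul_nonneg (hψ0 _)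
      (mul_nonneg (norm_nonneg _) (norm_nonneg _)))) hle hboth.summable
  have h7 := hasSum_le hle hsum.hasSum hboth
  have h8 : ‖u n‖ ^ 2 ≤ C ^ 2 := pow_le_pow_left₀ (norm_nonneg _) (hC n) 2
  have h9 := mul_le_mul_of_nonneg_left h8 hε'.le
  linarith

theorem tsum_norm_coeff_mul_le (u : L2 d) (j : Fin d → ℤ) :
    (2 * π) ^ d * ∑' k, ‖coeff u k‖ * ‖coeff u (k + j)‖ ≤ ‖u‖ ^ 2 := by
  rw [← tsum_norm_coeff_sq]
  refine mul_le_mul_of_nonneg_left ?_ (pow_pos Real.two_pi_pos d).le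
  have h1 := (summable_norm_coeff_sq (Lp.memLp u)).hasSum
  have h2 := ((h1.add ((Equiv.addRight j).hasSum_iff.2 h1)).mul_left (1 / 2))
  refine (hasSum_le (fun k => ?_) (summable_norm_coeff_mul u j).hasSum h2).trans_eq (by ring)
  have := two_mul_le_add_sq ‖coeff u k‖ ‖coeff u (k + j)‖
  simp only [Function.comp_apply, Equiv.coe_addRight]
  linarith

theorem integrable_comp_snd {μ₀ : Measure (Phase d)} [IsLocallyFiniteMeasure μ₀]
    {E : Type*} [NormedAddCommGroup E] {f : Euc d → E} (hf : Continuous f)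
    (hc : HasCompactSupport f) :
    Integrable (fun p : Phase d => f p.2) μ₀ := by
  refine (hf.comp continuous_snd).integrable_of_hasCompactSupport ?_
  refine HasCompactSupport.intro (isCompact_univ.prod hc) fun p hp => ?_
  exact image_eq_zero_of_notMem_tsupport (f := f) fun h => hp ⟨Set.mem_univ _, h⟩

/-- A cut-off to a neighbourhood of the hyperplane `j · ξ = 0` with small mass. -/
theorem exists_resonant_cutoff {μ₀ : Measure (Phase d)} [IsLocallyFiniteMeasure μ₀]
    (hΩ : μ₀ (Set.univ ×ˢ resonantSet d) = 0) {j : Fin d → ℤ} (hj : j ≠ 0)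
    {K : Set (Euc d)} (hK : IsCompact K) {ε : ℝ} (hε : 0 < ε) :
    ∃ δ > 0, ∃ ψ : Euc d → ℝ, ContDiff ℝ ∞ ψ ∧ HasCompactSupport ψ ∧ (∀ ξ, 0 ≤ ψ ξ) ∧
      (∀ ξ ∈ K, |pairing j ξ| ≤ δ → ψ ξ = 1) ∧ ∫ p, ψ p.2 ∂μ₀ ≤ ε := by
  obtain ⟨R, hR0, hR⟩ := hK.isBounded.subset_closedBall_lt 0 0
  let β : ContDiffBump (0 : Euc d) := ⟨R, R + 1, hR0, by linarith⟩
  let δ : ℕ → ℝ := fun m => 1 / ((m : ℝ) + 1)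
  have hδ : ∀ m, 0 < δ m := fun m => Nat.one_div_pos_of_nat
  -- `ρ m` is 1 on `|s| ≤ δ m` and 0 for `|s| ≥ 2 δ m`. Off the hyperplane `ψ m` is eventually 0,
  -- and `β` dominates, so its mass tends to 0 because `μ₀` ignores resonant frequencies.
  let ρ : ∀ m, ContDiffBump (0 : ℝ) := fun m => ⟨δ m, 2 * δ m, hδ m, by linarith [hδ m]⟩
  let ψ : ℕ → Euc d → ℝ := fun m ξ => β ξ * ρ m (pairing j ξ)
  have hψ : ∀ m, ContDiff ℝ ∞ (ψ m) := fun m =>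
    β.contDiff.mul ((ρ m).contDiff.comp (contDiff_pairing j))
  have hlim : Tendsto (fun m => ∫ p, ψ m p.2 ∂μ₀) atTop (𝓝 (∫ _, (0 : ℝ) ∂μ₀)) := by
    refine tendsto_integral_of_dominated_convergence (fun p : Phase d => β p.2)
      (fun m => ((hψ m).continuous.comp continuous_snd).aestronglyMeasurable)
      (integrable_comp_snd β.continuous β.hasCompactSupport)
      (fun m => Eventually.of_forall fun p => ?_) ?_
    · rw [Real.norm_of_nonneg (mul_nonneg β.nonneg (ρ m).nonneg)]
      exact mul_le_of_le_one_right β.nonneg (ρ m).le_one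
    · have : ∀ᵐ p ∂μ₀, p ∉ Set.univ ×ˢ resonantSet d := measure_eq_zero_iff_ae_notMem.1 hΩ
      filter_upwards [this] with p hp
      have hp0 : pairing j p.2 ≠ 0 := fun h => hp ⟨Set.mem_univ _, j, hj, h⟩
      have hlim0 : Tendsto (fun m => 2 * δ m) atTop (𝓝 0) := by
        simpa only [mul_zero] using tendsto_one_div_add_atTop_nhds_zero_nat.const_mul (2 : ℝ)
      refine tendsto_const_nhds.congr' ?_
      filter_upwards [hlim0.eventually (gt_mem_nhds (abs_pos.2 hp0))] with m hm
      have : ρ m (pairing j p.2) = 0 := (ρ m).zero_of_le_dist (by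
        rw [dist_zero_right, Real.norm_eq_abs]; exact hm.le)
      simp only [ψ, this, mul_zero]
  rw [integral_zero] at hlim
  obtain ⟨m, hm⟩ := (hlim.eventually (ge_mem_nhds hε)).exists
  refine ⟨δ m, hδ m, ψ m, hψ m, β.hasCompactSupport.mul_right,
    fun ξ => mul_nonneg β.nonneg (ρ m).nonneg, fun ξ hξ h => ?_, hm⟩
  have h1 : β ξ = 1 := β.one_of_mem_closedBall (hR hξ)
  have h2 : ρ m (pairing j ξ) = 1 := (ρ m).one_of_mem_closedBall (by
    rw [mem_closedBall_zero_iff, Real.norm_eq_abs]; exact h)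
  simp only [ψ, h1, h2, mul_one]

/-- Time averages of the nonzero Fourier modes of the evolved Wigner distributions vanish in the
limit. -/
theorem tendsto_integral_wigner_modeSymbol {h α : ℕ → ℝ} (h_pos : ∀ n, 0 < h n)
    (h_lim : Tendsto h atTop (𝓝 0)) (α_lim : Tendsto α atTop atTop)
    {u : ℕ → L2 d} {C : ℝ} (hC : ∀ n, ‖u n‖ ≤ C)
    {μ₀ : Measure (Phase d)} [IsLocallyFiniteMeasure μ₀] (hμ₀ : IsSemiclassicalMeasure h u μ₀)
    (hΩ : μ₀ (Set.univ ×ˢ resonantSet d) = 0) {j : Fin d → ℤ} (hj : j ≠ 0)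
    {b : Euc d → ℂ} (hb : ContDiff ℝ ∞ b) (hc : HasCompactSupport b) {φ : ℝ → ℂ}
    (hφ : Integrable φ) :
    Tendsto (fun n => ∫ t, φ t * wigner (h n) (schrodinger (α n * h n * t) (u n))
      (modeSymbol j b)) atTop (𝓝 0) := by
  obtain ⟨M, hM⟩ := hb.continuous.bounded_above_of_compact_support hc
  have hM0 : 0 ≤ M := (norm_nonneg _).trans (hM 0)
  set N := ∫ t, ‖φ t‖ with hN
  have hN0 : 0 ≤ N := integral_nonneg fun t => norm_nonneg _
  have hV : (0 : ℝ) < (2 * π) ^ d := pow_pos Real.two_pi_pos d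
  -- `M * C ^ 2` comes from the nonresonant frequencies. In `M * N * 2` one unit is the `μ₀`-mass of
  -- the cut-off and the other the error in reaching it.
  have key : ∀ ε > 0, ∀ᶠ n in atTop, ‖∫ t, φ t * wigner (h n)
      (schrodinger (α n * h n * t) (u n)) (modeSymbol j b)‖ ≤ (M * C ^ 2 + M * N * 2) * ε := by
    intro ε hε
    obtain ⟨δ, hδ, ψ, hψ, hψc, hψ0, hψ1, hψm⟩ := exists_resonant_cutoff hΩ hj hc hε
    obtain ⟨S, hS⟩ := exists_norm_fourierIntegral_le φ hε
    filter_upwards [eventually_tsum_correlation_le h_pos h_lim hC hμ₀ j hψ hψc hψ0 hε,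
      α_lim.eventually_ge_atTop (S / δ), α_lim.eventually_ge_atTop 0] with n h1 h2 h3
    rw [div_le_iff₀ hδ] at h2
    have hA := hasSum_integral_wigner (h_pos n).ne' (α n) (u n) j hb hc hφ
    have hle : ∀ k, ‖((2 * π : ℝ) : ℂ) ^ d * (b (midFreq (h n) j k) *
        (fourierIntegral φ (α n * pairing j (midFreq (h n) j k)) *
          (coeff (u n) k * starRingEnd ℂ (coeff (u n) (k + j)))))‖
        ≤ (M * ε * (2 * π) ^ d) * (‖coeff (u n) k‖ * ‖coeff (u n) (k + j)‖)
          + (M * N * (2 * π) ^ d) * (ψ (midFreq (h n) j k) *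
            (‖coeff (u n) k‖ * ‖coeff (u n) (k + j)‖)) := by
      intro k
      set η := midFreq (h n) j k
      -- Near the hyperplane `ψ η = 1` absorbs the trivial bound `N`; away from it `α n ≥ S / δ`
      -- pushes the argument beyond `S`.
      have hbF : ‖b η‖ * ‖fourierIntegral φ (α n * pairing j η)‖ ≤ M * ε + M * N * ψ η := by
        by_cases hη : η ∈ tsupport b
        · by_cases hp : |pairing j η| ≤ δ
          · rw [hψ1 η hη hp, mul_one]
            have := mul_le_mul (hM η) (norm_fourierIntegral_le φ (α n * pairing j η))
              (norm_nonneg _) hM0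
            have := mul_nonneg hM0 hε.le
            linarith
          · have : S ≤ |α n * pairing j η| := by
              rw [abs_mul, abs_of_nonneg h3]
              exact h2.trans (mul_le_mul_of_nonneg_left (not_le.1 hp).le h3)
            have := mul_le_mul (hM η) (hS _ this) (norm_nonneg _) hM0
            have := mul_nonneg (mul_nonneg hM0 hN0) (hψ0 η)
            linarith
        · rw [image_eq_zero_of_notMem_tsupport hη, norm_zero, zero_mul]
          exact add_nonneg (mul_nonneg hM0 hε.le) (mul_nonneg (mul_nonneg hM0 hN0) (hψ0 η))
      have hc0 : 0 ≤ (2 * π) ^ d * (‖coeff (u n) k‖ * ‖coeff (u n) (k + j)‖) :=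
        mul_nonneg hV.le (mul_nonneg (norm_nonneg _) (norm_nonneg _))
      rw [norm_mul, norm_mul, norm_mul, norm_mul, norm_pow, Complex.norm_real, RCLike.norm_conj,
        Real.norm_of_nonneg Real.two_pi_pos.le]
      calc _ = (‖b η‖ * ‖fourierIntegral φ (α n * pairing j η)‖) *
            ((2 * π) ^ d * (‖coeff (u n) k‖ * ‖coeff (u n) (k + j)‖)) := by ring
        _ ≤ (M * ε + M * N * ψ η) *
            ((2 * π) ^ d * (‖coeff (u n) k‖ * ‖coeff (u n) (k + j)‖)) :=
          mul_le_mul_of_nonneg_right hbF hc0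
        _ = _ := by ring
    obtain ⟨Mψ, hMψ⟩ := hψ.continuous.bounded_above_of_compact_support hψc
    have hs1 := summable_norm_coeff_mul (u n) j
    have hs2 : Summable fun k => ψ (midFreq (h n) j k) *
        (‖coeff (u n) k‖ * ‖coeff (u n) (k + j)‖) := by
      refine Summable.of_nonneg_of_le (fun k => mul_nonneg (hψ0 _)
        (mul_nonneg (norm_nonneg _) (norm_nonneg _))) (fun k => ?_) (hs1.mul_left Mψ)
      exact mul_le_mul_of_nonneg_right ((le_abs_self _).trans (hMψ _))
        (mul_nonneg (norm_nonneg _) (norm_nonneg _))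
    have hs := (hs1.hasSum.mul_left (M * ε * (2 * π) ^ d)).add
      (hs2.hasSum.mul_left (M * N * (2 * π) ^ d))
    rw [← hA.tsum_eq]
    refine (tsum_of_norm_bounded hs hle).trans ?_
    have h4 := (tsum_norm_coeff_mul_le (u n) j).trans
      (pow_le_pow_left₀ (norm_nonneg _) (hC n) 2)
    have h5 := mul_le_mul_of_nonneg_left h4 (mul_nonneg hM0 hε.le)
    have h6 := mul_le_mul_of_nonneg_left (h1.trans (add_le_add_left hψm ε))
      (mul_nonneg hM0 hN0)
    linarith
  rw [tendsto_zero_iff_norm_tendsto_zero]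
  have hL0 : 0 ≤ M * C ^ 2 + M * N * 2 := by positivity
  rw [Metric.tendsto_nhds]
  intro ε hε
  filter_upwards [key (ε / (2 * (M * C ^ 2 + M * N * 2 + 1))) (by positivity)] with n hn
  rw [dist_zero_right, norm_norm]
  refine hn.trans_lt ?_
  rw [mul_div_assoc', div_lt_iff₀ (by positivity)]
  nlinarith

end Evolution

/-! ### From Fourier modes to the identification of `μ t`. -/

section Uniqueness

variable {d : ℕ}

/-- A measurable version of `μ` is a kernel, and integrals against a kernel are measurable in the
parameter. -/
theorem aestronglyMeasurable_integral_measureValued {μ : ℝ → Measure (Phase d)}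
    (hμ : AEMeasurable μ volume) {f : Phase d → ℂ} (hf : Continuous f) :
    AEStronglyMeasurable (fun t => ∫ p, f p ∂(μ t)) volume := by
  let κ : ProbabilityTheory.Kernel ℝ (Phase d) := ⟨hμ.mk μ, hμ.measurable_mk⟩
  refine ⟨fun t => ∫ p, f p ∂(κ t), hf.stronglyMeasurable.integral_kernel, ?_⟩
  filter_upwards [hμ.ae_eq_mk] with t ht
  rw [ht]
  rfl

theorem continuous_modeSymbol (j : Fin d → ℤ) {b : Euc d → ℂ} (hb : Continuous b) :
    Continuous (modeSymbol j b) :=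
  ((planeWave j).continuous.comp continuous_fst).mul (hb.comp continuous_snd)

theorem norm_modeSymbol (j : Fin d → ℤ) (b : Euc d → ℂ) (p : Phase d) :
    ‖modeSymbol j b p‖ = ‖b p.2‖ := by
  rw [modeSymbol, norm_mul, norm_planeWave, one_mul]

/-- A bounded family of integrals is determined by its weak time averages. -/
theorem ae_integral_eq_of_forall_integral_mul_eq {μ : ℝ → Measure (Phase d)}
    (hμ : IsLInftyMeasureValued μ) {f : Phase d → ℂ} (hf : Continuous f) {M : ℝ}
    (hM : ∀ p, ‖f p‖ ≤ M) {c : ℂ}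
    (h : ∀ φ : ℝ → ℂ, Integrable φ → ∫ t, φ t * ∫ p, f p ∂(μ t) = (∫ t, φ t) * c) :
    ∀ᵐ t, ∫ p, f p ∂(μ t) = c := by
  obtain ⟨hm, C, hC⟩ := hμ
  have hmeas := aestronglyMeasurable_integral_measureValued hm hf
  have hb : ∀ᵐ t, ‖∫ p, f p ∂(μ t)‖ ≤ M * C := by
    filter_upwards [hC] with t ht
    have hfin : IsFiniteMeasure (μ t) := ⟨ht.trans_lt ENNReal.coe_lt_top⟩
    have hM0 : 0 ≤ M := (norm_nonneg _).trans (hM ((0 : Torus d), (0 : Euc d)))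
    refine (norm_integral_le_of_norm_le_const (Eventually.of_forall hM)).trans ?_
    refine mul_le_mul_of_nonneg_left ?_ hM0
    exact ENNReal.toReal_le_coe_of_le_coe ht
  have hInt : ∀ s : Set ℝ, MeasurableSet s → volume s < ⊤ →
      IntegrableOn (fun t => ∫ p, f p ∂(μ t)) s volume := fun s _ hs' =>
    Measure.integrableOn_of_bounded hs'.ne hmeas (ae_restrict_of_ae hb)
  have key := ae_eq_zero_of_forall_setIntegral_eq_of_sigmaFinite (μ := (volume : Measure ℝ))
    (f := fun t => (∫ p, f p ∂(μ t)) - c)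
    (fun s hs hs' => (hInt s hs hs').sub (integrableOn_const hs'.ne)) (fun s hs hs' => by
      rw [integral_sub (hInt s hs hs') (integrableOn_const hs'.ne)]
      -- Testing with `φ = 1_s` gives the integral over every set of finite measure.
      have hi : Integrable (s.indicator (fun _ => (1 : ℂ))) volume :=
        (integrable_indicator_iff hs).2 (integrableOn_const hs'.ne)
      have h1 := h _ hi
      have e : (fun t => s.indicator (fun _ => (1 : ℂ)) t * ∫ p, f p ∂(μ t))
          = s.indicator fun t => ∫ p, f p ∂(μ t) := by
        ext t
        by_cases ht : t ∈ s <;> simp [ht]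
      rw [e, integral_indicator hs, integral_indicator hs] at h1
      rw [h1, ← integral_mul_const, sub_eq_zero]
      simp)
  filter_upwards [key] with t ht
  exact sub_eq_zero.1 ht

/-- The Fourier modes of the evolution measure, at almost every time. -/
theorem ae_integral_modeSymbol {h α : ℕ → ℝ} (h_pos : ∀ n, 0 < h n)
    (h_lim : Tendsto h atTop (𝓝 0)) (α_lim : Tendsto α atTop atTop)
    {u : ℕ → L2 d} {C : ℝ} (hC : ∀ n, ‖u n‖ ≤ C)
    {μ₀ : Measure (Phase d)} [IsLocallyFiniteMeasure μ₀] (hμ₀ : IsSemiclassicalMeasure h u μ₀)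
    {μ : ℝ → Measure (Phase d)} (μ_Linfty : IsLInftyMeasureValued μ)
    (hμ : IsEvolutionMeasure h α u μ)
    (hΩ : μ₀ (Set.univ ×ˢ resonantSet d) = 0) (j : Fin d → ℤ)
    {b : Euc d → ℂ} (hb : ContDiff ℝ ∞ b) (hc : HasCompactSupport b) :
    ∀ᵐ t, ∫ p, modeSymbol j b p ∂(μ t) = if j = 0 then ∫ p, b p.2 ∂μ₀ else 0 := by
  obtain ⟨M, hM⟩ := hb.continuous.bounded_above_of_compact_support hc
  refine ae_integral_eq_of_forall_integral_mul_eq μ_Linfty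
    (continuous_modeSymbol j hb.continuous) (M := M)
    (fun p => (norm_modeSymbol j b p).trans_le (hM _)) fun φ hφ => ?_
  refine tendsto_nhds_unique (hμ φ hφ _ (isSymbol_modeSymbol j hb hc)) ?_
  split_ifs with hj
  · subst hj
    simp_rw [fun n => integral_wigner_modeSymbol_zero (h_pos n).ne' (α n) (u n) hb hc hφ]
    have := (hμ₀ _ (isSymbol_modeSymbol 0 hb hc)).const_mul (∫ t, φ t)
    simp_rw [modeSymbol_zero] at this
    exact this
  · rw [mul_zero]
    exact tendsto_integral_wigner_modeSymbol h_pos h_lim α_lim hC hμ₀ hΩ hj hb hc hφ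

theorem continuous_integral_continuousMap {X : Type*} [TopologicalSpace X] [CompactSpace X]
    [MeasurableSpace X] [OpensMeasurableSpace X] (ν : Measure X)
    [IsFiniteMeasure ν] : Continuous fun f : C(X, ℂ) => ∫ x, f x ∂ν := by
  have hi : ∀ f : C(X, ℂ), Integrable f ν := fun f =>
    Integrable.of_bound f.continuous.aestronglyMeasurable ‖f‖
      (Eventually.of_forall f.norm_coe_le_norm)
  refine (LipschitzWith.of_dist_le_mul (K := (ν.real Set.univ).toNNReal) fun f g => ?_).continuous
  rw [dist_eq_norm, dist_eq_norm, ← integral_sub (hi f) (hi g),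
    Real.coe_toNNReal _ measureReal_nonneg, mul_comm]
  exact norm_integral_le_of_norm_le_const (Eventually.of_forall (f - g).norm_coe_le_norm)

/-- A finite measure on the torus is determined by its Fourier coefficients. -/
theorem ext_of_integral_planeWave {ν₁ ν₂ : Measure (Torus d)} [IsFiniteMeasure ν₁]
    [IsFiniteMeasure ν₂] (h : ∀ j, ∫ x, planeWave j x ∂ν₁ = ∫ x, planeWave j x ∂ν₂) :
    ν₁ = ν₂ := by
  have hi : ∀ (ν : Measure (Torus d)) [IsFiniteMeasure ν] (f : C(Torus d, ℂ)), Integrable f ν :=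
    fun ν _ f => Integrable.of_bound f.continuous.aestronglyMeasurable ‖f‖
      (Eventually.of_forall f.norm_coe_le_norm)
  have hall : ∀ f : C(Torus d, ℂ), ∫ x, f x ∂ν₁ = ∫ x, f x ∂ν₂ := by
    intro f
    have hcl : IsClosed {f : C(Torus d, ℂ) | ∫ x, f x ∂ν₁ = ∫ x, f x ∂ν₂} :=
      isClosed_eq (continuous_integral_continuousMap ν₁) (continuous_integral_continuousMap ν₂)
    refine closure_minimal (fun g hg => ?_) hcl (mem_closure_span_planeWave f)
    refine Submodule.span_induction ?_ ?_ ?_ ?_ hg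
    · rintro _ ⟨j, rfl⟩; exact h j
    · simp
    · intro g₁ g₂ _ _ h₁ h₂
      simp only [Set.mem_ofPred_eq, ContinuousMap.add_apply] at h₁ h₂ ⊢
      rw [integral_add (hi _ g₁) (hi _ g₂), integral_add (hi _ g₁) (hi _ g₂), h₁, h₂]
    · intro c g _ h₁
      simp only [Set.mem_ofPred_eq, ContinuousMap.smul_apply] at h₁ ⊢
      rw [integral_smul, integral_smul, h₁]
  refine ext_of_forall_integral_eq_of_IsFiniteMeasure fun f => ?_
  have := hall ⟨fun x => (f x : ℂ), Complex.continuous_ofReal.comp f.continuous⟩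
  simp only [ContinuousMap.coe_mk] at this
  have e : ∀ ν : Measure (Torus d), ∫ x, (f x : ℂ) ∂ν = ((∫ x, f x ∂ν : ℝ) : ℂ) :=
    fun ν => integral_ofReal
  rw [e, e] at this
  exact_mod_cast this

/-- The normalized Haar measure of the torus. -/
noncomputable def torusProb (d : ℕ) : Measure (Torus d) :=
  (volume (Set.univ : Set (Torus d)))⁻¹ • volume

instance isProbabilityMeasure_torusProb : IsProbabilityMeasure (torusProb d) :=
  ⟨by
    rw [torusProb, Measure.smul_apply, smul_eq_mul]
    exact ENNReal.inv_mul_cancel (IsOpen.measure_ne_zero _ isOpen_univ Set.univ_nonempty)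
      (measure_ne_top _ _)⟩

theorem integral_planeWave_torusProb (j : Fin d → ℤ) :
    ∫ x, planeWave j x ∂(torusProb d) = if j = 0 then 1 else 0 := by
  have h2 : ((2 * π : ℝ) : ℂ) ^ d ≠ 0 :=
    pow_ne_zero _ (by exact_mod_cast Real.two_pi_pos.ne')
  rw [torusProb, integral_smul_measure, integral_planeWave, ENNReal.toReal_inv,
    ← measureReal_def, measureReal_univ_torus]
  split_ifs
  · rw [Complex.real_smul, Complex.ofReal_inv, Complex.ofReal_pow, inv_mul_cancel₀ h2]
  · simp

/-- A countable `π`-system of bounded open sets. -/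
def boundedOpens (E : Type*) [NormedAddCommGroup E] [SecondCountableTopology E] : Set (Set E) :=
  (fun q : ℕ × Set (Set E) => Metric.ball (0 : E) q.1 ∩ ⋂₀ q.2) ''
    (Set.univ ×ˢ {F | F.Finite ∧ F ⊆ TopologicalSpace.countableBasis E})

section BoundedOpens

variable {E : Type*} [NormedAddCommGroup E] [SecondCountableTopology E]

/-- Countability allows the exceptional null sets of times in `ae_eq_prod` to be merged; boundedness
keeps the mass of `𝕋ᵈ × U` under `μ₀` finite. -/
theorem countable_boundedOpens : (boundedOpens E).Countable :=
  (Set.countable_univ.prod (Set.countable_ofPred_finite_subset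
    (TopologicalSpace.countable_countableBasis E))).image _

theorem isOpen_of_mem_boundedOpens {U : Set E} (hU : U ∈ boundedOpens E) : IsOpen U := by
  obtain ⟨q, ⟨-, hq1, hq2⟩, rfl⟩ := hU
  exact Metric.isOpen_ball.inter (hq1.isOpen_sInter fun V hV =>
    TopologicalSpace.isOpen_of_mem_countableBasis (hq2 hV))

theorem isBounded_of_mem_boundedOpens {U : Set E} (hU : U ∈ boundedOpens E) :
    Bornology.IsBounded U := by
  obtain ⟨q, -, rfl⟩ := hU
  exact Metric.isBounded_ball.subset Set.inter_subset_left

theorem ball_mem_boundedOpens (n : ℕ) : Metric.ball (0 : E) n ∈ boundedOpens E :=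
  ⟨(n, ∅), ⟨Set.mem_univ _, Set.finite_empty, Set.empty_subset _⟩, by simp⟩

theorem isPiSystem_boundedOpens : IsPiSystem (boundedOpens E) := by
  rintro _ ⟨⟨n, F⟩, ⟨-, hF1, hF2⟩, rfl⟩ _ ⟨⟨m, G⟩, ⟨-, hG1, hG2⟩, rfl⟩ -
  refine ⟨(min n m, F ∪ G), ⟨Set.mem_univ _, hF1.union hG1, Set.union_subset hF2 hG2⟩, ?_⟩
  simp only [Set.sInter_union, Nat.cast_min]
  rw [Set.inter_inter_inter_comm]
  congr 1
  ext x
  simp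

theorem generateFrom_boundedOpens [MeasurableSpace E] [BorelSpace E] :
    MeasurableSpace.generateFrom (boundedOpens E) = ‹MeasurableSpace E› := by
  refine le_antisymm (MeasurableSpace.generateFrom_le fun U hU =>
    (isOpen_of_mem_boundedOpens hU).measurableSet) ?_
  rw [BorelSpace.measurable_eq (α := E),
    (TopologicalSpace.isBasis_countableBasis E).borel_eq_generateFrom]
  refine MeasurableSpace.generateFrom_le fun V hV => ?_
  have : V = ⋃ n : ℕ, Metric.ball (0 : E) n ∩ ⋂₀ {V} := by
    rw [← Set.iUnion_inter, Metric.iUnion_ball_nat, Set.univ_inter, Set.sInter_singleton]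
  rw [this]
  refine MeasurableSet.iUnion fun n => MeasurableSpace.measurableSet_generateFrom ?_
  exact ⟨(n, {V}), ⟨Set.mem_univ _, Set.finite_singleton _, Set.singleton_subset_iff.2 hV⟩, rfl⟩

end BoundedOpens

/-- The indicator of a bounded open set is a limit of test functions. -/
theorem exists_tendsto_indicator {E : Type*} [NormedAddCommGroup E] [NormedSpace ℝ E]
    [FiniteDimensional ℝ E] {U : Set E}
    (hU : IsOpen U) (hb : Bornology.IsBounded U) :
    ∃ f : ℕ → E → ℂ, (∀ m, ContDiff ℝ ∞ (f m)) ∧ (∀ m, HasCompactSupport (f m)) ∧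
      (∀ m x, ‖f m x‖ ≤ U.indicator 1 x) ∧
      ∀ x, Tendsto (fun m => f m x) atTop (𝓝 (U.indicator 1 x)) := by
  -- With `g` smooth and positive exactly on `U`, the smooth step of `m * g` vanishes off `U` and
  -- equals 1 at each point of `U` once `m * g ≥ 1`.
  obtain ⟨g, hg, hgs, hgr⟩ := hU.exists_contDiff_support_eq (n := ⊤)
  have hg0 : ∀ x, x ∉ U → g x = 0 := fun x hx => by
    rw [← hg] at hx; exact Function.notMem_support.1 hx
  have hgp : ∀ x ∈ U, 0 < g x := fun x hx => by
    rw [← hg] at hx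
    exact lt_of_le_of_ne (hgr ⟨x, rfl⟩).1 (Ne.symm hx)
  have hz : ∀ (m : ℕ) x, x ∉ U → ((Real.smoothTransition (m * g x) : ℝ) : ℂ) = 0 := fun m x hx => by
    rw [hg0 x hx, mul_zero, Real.smoothTransition.zero, Complex.ofReal_zero]
  refine ⟨fun m x => ((Real.smoothTransition (m * g x) : ℝ) : ℂ), fun m => ?_, fun m => ?_,
    fun m x => ?_, fun x => ?_⟩
  · exact Complex.ofRealCLM.contDiff.comp
      (Real.smoothTransition.contDiff.comp (contDiff_const.mul hgs))
  · exact HasCompactSupport.intro hb.isCompact_closure fun x hx =>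
      hz m x fun h => hx (subset_closure h)
  · by_cases hx : x ∈ U
    · rw [Set.indicator_of_mem hx, Complex.norm_real, Pi.one_apply,
        Real.norm_of_nonneg (Real.smoothTransition.nonneg _)]
      exact Real.smoothTransition.le_one _
    · simp only [hz m x hx]
      rw [norm_zero, Set.indicator_of_notMem hx]
  · by_cases hx : x ∈ U
    · rw [Set.indicator_of_mem hx, Pi.one_apply]
      refine tendsto_const_nhds.congr' ?_
      filter_upwards [(tendsto_natCast_atTop_atTop.atTop_mul_const
        (hgp x hx)).eventually_ge_atTop (1 : ℝ)] with m hm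
      rw [Real.smoothTransition.one_of_one_le hm, Complex.ofReal_one]
    · rw [Set.indicator_of_notMem hx]
      refine tendsto_const_nhds.congr fun m => (hz m x hx).symm

theorem measure_univ_prod_lt_top (μ₀ : Measure (Phase d)) [IsLocallyFiniteMeasure μ₀]
    {U : Set (Euc d)} (hb : Bornology.IsBounded U) : μ₀ (Set.univ ×ˢ U) < ⊤ :=
  (measure_mono (Set.prod_mono_right subset_closure)).trans_lt
    (isCompact_univ.prod hb.isCompact_closure).measure_lt_top

/-- Dominated convergence, applied both to `μ t` and to `μ₀`, to pass from smooth cut-offs to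
indicators. -/
theorem tendsto_integral_modeSymbol (ν : Measure (Phase d)) (j : Fin d → ℤ) {U : Set (Euc d)}
    (hU : IsOpen U) (hν : ν (Set.univ ×ˢ U) < ⊤) {f : ℕ → Euc d → ℂ}
    (hf : ∀ m, Continuous (f m)) (hfb : ∀ m x, ‖f m x‖ ≤ U.indicator 1 x)
    (hlim : ∀ x, Tendsto (fun m => f m x) atTop (𝓝 (U.indicator 1 x))) :
    Tendsto (fun m => ∫ p, modeSymbol j (f m) p ∂ν) atTop
      (𝓝 (∫ p in Set.univ ×ˢ U, planeWave j p.1 ∂ν)) := by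
  have hm : MeasurableSet (Set.univ ×ˢ U : Set (Phase d)) :=
    MeasurableSet.univ.prod hU.measurableSet
  rw [← integral_indicator hm]
  refine tendsto_integral_of_dominated_convergence
    ((Set.univ ×ˢ U : Set (Phase d)).indicator (fun _ => (1 : ℝ)))
    (fun m => (continuous_modeSymbol j (hf m)).aestronglyMeasurable)
    ((integrable_indicator_iff hm).2 (integrableOn_const hν.ne))
    (fun m => Eventually.of_forall fun p => ?_) (Eventually.of_forall fun p => ?_)
  · rw [norm_modeSymbol]
    refine (hfb m p.2).trans_eq ?_
    by_cases hp : p.2 ∈ U <;> simp [hp]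
  · have := (hlim p.2).const_mul (planeWave j p.1)
    by_cases hp : p.2 ∈ U <;> simpa [hp, modeSymbol] using this

/-- At almost every time the evolution measure is the product of the Haar measure of the torus and
the projection of the initial measure to the frequency space. -/
theorem eq_prod_of_integral_modeSymbol {μ₀ : Measure (Phase d)} [IsLocallyFiniteMeasure μ₀]
    {ν : Measure (Phase d)} [IsFiniteMeasure ν]
    (h : ∀ U ∈ boundedOpens (Euc d), ∀ j, ∫ p in Set.univ ×ˢ U, planeWave j p.1 ∂ν
      = if j = 0 then (μ₀.real (Set.univ ×ˢ U) : ℂ) else 0) :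
    ν = (torusProb d).prod (μ₀.map Prod.snd) := by
  have hsnd : ∀ U : Set (Euc d), MeasurableSet U → μ₀.map Prod.snd U = μ₀ (Set.univ ×ˢ U) := by
    intro U hU
    rw [Measure.map_apply measurable_snd hU, ← Set.univ_prod]
  symm
  refine Measure.prod_eq_generateFrom MeasurableSpace.generateFrom_measurableSet
    generateFrom_boundedOpens MeasurableSpace.isPiSystem_measurableSet isPiSystem_boundedOpens
    (torusProb d).toFiniteSpanningSetsIn
    ⟨fun n => Metric.ball 0 n, ball_mem_boundedOpens, fun n => ?_, Metric.iUnion_ball_nat 0⟩ ?_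
  · rw [hsnd _ measurableSet_ball]
    exact measure_univ_prod_lt_top μ₀ Metric.isBounded_ball
  · intro A hA U hU
    have hA' : MeasurableSet A := hA
    have hUo := (isOpen_of_mem_boundedOpens hU).measurableSet
    have hfin := measure_univ_prod_lt_top μ₀ (isBounded_of_mem_boundedOpens hU)
    -- The part of `ν` over `U`, pushed to the torus, has the Fourier coefficients of a multiple of
    -- Haar measure, and these determine it.
    have key : (ν.restrict (Set.univ ×ˢ U)).map Prod.fst
        = (μ₀ (Set.univ ×ˢ U)) • torusProb d := by
      have : IsFiniteMeasure ((μ₀ (Set.univ ×ˢ U)) • torusProb d) :=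
        Measure.smul_finite _ hfin.ne
      refine ext_of_integral_planeWave fun j => ?_
      rw [integral_map measurable_fst.aemeasurable
        (planeWave j).continuous.aestronglyMeasurable, h U hU j, integral_smul_measure,
        integral_planeWave_torusProb]
      split_ifs
      · rw [Complex.real_smul, mul_one, measureReal_def]
      · rw [smul_zero]
    have := congrArg (fun m => m A) key
    simp only [Measure.smul_apply, smul_eq_mul] at this
    rw [Measure.map_apply measurable_fst hA', Measure.restrict_apply (measurable_fst hA')] at this
    rw [hsnd U hUo, mul_comm (torusProb d A), ← this]
    congr 1
    ext p; simp

/-- Each mode, set `U` and approximant has its own null set of times; all three range over countable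
families. -/
theorem ae_eq_prod {h α : ℕ → ℝ} (h_pos : ∀ n, 0 < h n)
    (h_lim : Tendsto h atTop (𝓝 0)) (α_lim : Tendsto α atTop atTop)
    {u : ℕ → L2 d} {C : ℝ} (hC : ∀ n, ‖u n‖ ≤ C)
    {μ₀ : Measure (Phase d)} [IsLocallyFiniteMeasure μ₀] (hμ₀ : IsSemiclassicalMeasure h u μ₀)
    {μ : ℝ → Measure (Phase d)} (μ_Linfty : IsLInftyMeasureValued μ)
    (hμ : IsEvolutionMeasure h α u μ) (hΩ : μ₀ (Set.univ ×ˢ resonantSet d) = 0) :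
    ∀ᵐ t, IsFiniteMeasure (μ t) ∧ μ t = (torusProb d).prod (μ₀.map Prod.snd) := by
  have hall : ∀ U ∈ boundedOpens (Euc d), ∀ᵐ t, ∀ j, IsFiniteMeasure (μ t) →
      ∫ p in Set.univ ×ˢ U, planeWave j p.1 ∂(μ t)
        = if j = 0 then (μ₀.real (Set.univ ×ˢ U) : ℂ) else 0 := by
    intro U hU
    have hUo := isOpen_of_mem_boundedOpens hU
    have hUb := isBounded_of_mem_boundedOpens hU
    obtain ⟨f, hf1, hf2, hf3, hf4⟩ := exists_tendsto_indicator hUo hUb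
    refine ae_all_iff.2 fun j => ?_
    have hm : ∀ᵐ t, ∀ m, ∫ p, modeSymbol j (f m) p ∂(μ t)
        = if j = 0 then ∫ p, f m p.2 ∂μ₀ else 0 :=
      ae_all_iff.2 fun m => ae_integral_modeSymbol h_pos h_lim α_lim hC hμ₀ μ_Linfty hμ hΩ j
        (hf1 m) (hf2 m)
    filter_upwards [hm] with t ht hfin
    have h1 := tendsto_integral_modeSymbol (μ t) j hUo (measure_lt_top _ _)
      (fun m => (hf1 m).continuous) hf3 hf4
    simp_rw [ht] at h1
    refine tendsto_nhds_unique h1 ?_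
    split_ifs with hj
    · have h2 := tendsto_integral_modeSymbol μ₀ 0 hUo (measure_univ_prod_lt_top μ₀ hUb)
        (fun m => (hf1 m).continuous) hf3 hf4
      simp_rw [modeSymbol_zero, planeWave_zero] at h2
      simpa using h2
    · exact tendsto_const_nhds
  have hall' := (ae_ball_iff countable_boundedOpens).2 hall
  obtain ⟨-, c, hc⟩ := μ_Linfty
  filter_upwards [hall', hc] with t ht hct
  have hfin : IsFiniteMeasure (μ t) := ⟨hct.trans_lt ENNReal.coe_lt_top⟩
  exact ⟨hfin, eq_prod_of_integral_modeSymbol fun U hU j => ht U hU j hfin⟩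

end Uniqueness

/-! ### Existence and value of geodesic averages. -/

section GeodesicAverages

variable {d : ℕ}

theorem isOpenQuotientMap_proj : IsOpenQuotientMap (proj : Euc d → Torus d) := by
  have h : IsOpenQuotientMap
      (Pi.map fun _ : Fin d => (QuotientAddGroup.mk : ℝ → AddCircle (2 * π))) :=
    IsOpenQuotientMap.piMap fun _ => QuotientAddGroup.isOpenQuotientMap_mk
  exact h.comp (PiLp.homeomorph 2 fun _ : Fin d => ℝ).isOpenQuotientMap

/-- Smoothness is stated on the periodic lift; continuity descends because the covering is a
quotient map. -/
theorem IsSymbol.continuous {a : Phase d → ℂ} (ha : IsSymbol a) : Continuous a := by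
  have h : IsOpenQuotientMap (Prod.map (proj : Euc d → Torus d) (id : Euc d → Euc d)) :=
    isOpenQuotientMap_proj.prodMap IsOpenQuotientMap.id
  exact h.isQuotientMap.continuous_iff.2 ha.1.continuous

/-- The time average of a continuous function along the line through `x` with direction `ξ`. -/
noncomputable def lineAverage (x : Torus d) (ξ : Euc d) (f : C(Torus d, ℂ)) (T : ℝ) : ℂ :=
  (T : ℂ)⁻¹ * ∫ s in (0 : ℝ)..T, f (x + proj (s • ξ))

theorem continuous_line (x : Torus d) (ξ : Euc d) : Continuous fun s : ℝ => x + proj (s • ξ) :=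
  continuous_const.add (continuous_proj.comp (continuous_id.smul continuous_const))

theorem intervalIntegrable_line (x : Torus d) (ξ : Euc d) (f : C(Torus d, ℂ)) (T : ℝ) :
    IntervalIntegrable (fun s : ℝ => f (x + proj (s • ξ))) volume 0 T :=
  (f.continuous.comp (continuous_line x ξ)).intervalIntegrable _ _

theorem lineAverage_add (x : Torus d) (ξ : Euc d) (f g : C(Torus d, ℂ)) (T : ℝ) :
    lineAverage x ξ (f + g) T = lineAverage x ξ f T + lineAverage x ξ g T := by
  simp only [lineAverage, ContinuousMap.add_apply]
  rw [intervalIntegral.integral_add (intervalIntegrable_line x ξ f T)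
    (intervalIntegrable_line x ξ g T), mul_add]

theorem lineAverage_zero (x : Torus d) (ξ : Euc d) (T : ℝ) : lineAverage x ξ 0 T = 0 := by
  simp [lineAverage]

theorem lineAverage_smul (x : Torus d) (ξ : Euc d) (c : ℂ) (f : C(Torus d, ℂ)) (T : ℝ) :
    lineAverage x ξ (c • f) T = c * lineAverage x ξ f T := by
  simp only [lineAverage, ContinuousMap.smul_apply, smul_eq_mul]
  rw [intervalIntegral.integral_const_mul, mul_left_comm]

theorem norm_inv_mul_intervalIntegral_le {g : ℝ → ℂ} {M : ℝ} (hM : ∀ s, ‖g s‖ ≤ M) (T : ℝ) :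
    ‖(T : ℂ)⁻¹ * ∫ s in (0 : ℝ)..T, g s‖ ≤ M := by
  have hM0 : 0 ≤ M := (norm_nonneg _).trans (hM 0)
  have h := intervalIntegral.norm_integral_le_of_norm_le_const (a := 0) (b := T) (fun s _ => hM s)
  rw [sub_zero] at h
  rw [norm_mul, norm_inv, Complex.norm_real, Real.norm_eq_abs]
  rcases eq_or_ne T 0 with rfl | hT
  · simpa using hM0
  · rw [inv_mul_le_iff₀ (abs_pos.2 hT), mul_comm]
    exact h

/-- Contraction uniform in `T`: this reduces statements about limits to trigonometric polynomials.
-/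
theorem dist_lineAverage_le (x : Torus d) (ξ : Euc d) (f g : C(Torus d, ℂ)) (T : ℝ) :
    dist (lineAverage x ξ f T) (lineAverage x ξ g T) ≤ dist f g := by
  have : lineAverage x ξ f T = lineAverage x ξ (f - g) T + lineAverage x ξ g T := by
    rw [← lineAverage_add, sub_add_cancel]
  rw [dist_eq_norm, dist_eq_norm, this, add_sub_cancel_right]
  exact norm_inv_mul_intervalIntegral_le (fun s => (f - g).norm_coe_le_norm _) T

/-- Along the line the wave is `e^{is j·ξ}` up to a constant: either it does not vary, or its
integral stays below `2 / |j·ξ|`. -/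
theorem tendsto_lineAverage_planeWave (x : Torus d) (ξ : Euc d) (j : Fin d → ℤ) :
    Tendsto (lineAverage x ξ (planeWave j)) atTop
      (𝓝 (if pairing j ξ = 0 then planeWave j x else 0)) := by
  have e : ∀ T, lineAverage x ξ (planeWave j) T = planeWave j x *
      ((T : ℂ)⁻¹ * ∫ s in (0 : ℝ)..T, Complex.exp (Complex.I * (pairing j ξ : ℂ) * s)) := by
    intro T
    rw [lineAverage, mul_left_comm]
    congr 1
    rw [← intervalIntegral.integral_const_mul]
    refine intervalIntegral.integral_congr fun s _ => ?_
    rw [planeWave_add, planeWave_proj, mul_assoc Complex.I, ← Complex.ofReal_mul]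
    congr 4
    rw [pairing, Finset.sum_mul]
    refine Finset.sum_congr rfl fun i _ => ?_
    simp
    ring
  split_ifs with h
  · refine tendsto_const_nhds.congr' ?_
    filter_upwards [eventually_gt_atTop 0] with T hT
    have : (T : ℂ) ≠ 0 := by exact_mod_cast hT.ne'
    rw [e, h]
    simp [this]
  · have hc : Complex.I * (pairing j ξ : ℂ) ≠ 0 :=
      mul_ne_zero Complex.I_ne_zero (by exact_mod_cast h)
    refine squeeze_zero_norm (a := fun T : ℝ => |T|⁻¹ * (2 / |pairing j ξ|)) (fun T => ?_) ?_
    · rw [e, integral_exp_mul_complex hc, norm_mul, norm_planeWave, one_mul, norm_mul, norm_inv,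
        Complex.norm_real, Real.norm_eq_abs, norm_div, norm_mul, Complex.norm_I, one_mul,
        Complex.norm_real, Real.norm_eq_abs]
      gcongr
      refine (norm_sub_le _ _).trans ?_
      rw [mul_assoc, mul_assoc, ← Complex.ofReal_mul, ← Complex.ofReal_mul, norm_exp_I_mul,
        norm_exp_I_mul]
      norm_num
    · have := (tendsto_inv_atTop_zero.comp tendsto_abs_atTop_atTop).mul_const (2 / |pairing j ξ|)
      rw [zero_mul] at this
      exact this

theorem exists_mem_span_planeWave_dist_lt (f : C(Torus d, ℂ)) {ε : ℝ} (hε : 0 < ε) :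
    ∃ g ∈ Submodule.span ℂ (Set.range (planeWave (d := d))), dist f g < ε := by
  exact Metric.mem_closure_iff.1 (mem_closure_span_planeWave f) ε hε

/-- Resonant directions are included: averages of polynomials converge, and uniform approximation
makes those of `f` Cauchy. -/
theorem exists_tendsto_lineAverage (x : Torus d) (ξ : Euc d) (f : C(Torus d, ℂ)) :
    ∃ L, Tendsto (lineAverage x ξ f) atTop (𝓝 L) := by
  have hspan : ∀ g ∈ Submodule.span ℂ (Set.range (planeWave (d := d))),
      ∃ L, Tendsto (lineAverage x ξ g) atTop (𝓝 L) := by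
    intro g hg
    refine Submodule.span_induction ?_ ?_ ?_ ?_ hg
    · rintro _ ⟨j, rfl⟩; exact ⟨_, tendsto_lineAverage_planeWave x ξ j⟩
    · exact ⟨0, tendsto_const_nhds.congr fun T => (lineAverage_zero x ξ T).symm⟩
    · rintro g₁ g₂ _ _ ⟨L₁, h₁⟩ ⟨L₂, h₂⟩
      exact ⟨L₁ + L₂, (h₁.add h₂).congr fun T => (lineAverage_add x ξ g₁ g₂ T).symm⟩
    · rintro c g _ ⟨L, hL⟩
      exact ⟨c * L, (hL.const_mul c).congr fun T => (lineAverage_smul x ξ c g T).symm⟩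
  refine cauchy_map_iff_exists_tendsto.1 (Metric.cauchy_iff.2 ⟨inferInstance, fun ε hε => ?_⟩)
  obtain ⟨g, hg, hfg⟩ := exists_mem_span_planeWave_dist_lt f (by positivity : 0 < ε / 4)
  obtain ⟨L, hL⟩ := hspan g hg
  refine ⟨Metric.ball L (ε / 2), ?_, fun y hy z hz => ?_⟩
  · rw [mem_map]
    filter_upwards [Metric.tendsto_nhds.1 hL (ε / 4) (by positivity)] with T hT
    have := dist_triangle (lineAverage x ξ f T) (lineAverage x ξ g T) L
    have := dist_lineAverage_le x ξ f g T
    rw [Set.mem_preimage, Metric.mem_ball]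
    linarith
  · have := dist_triangle_right y z L
    rw [Metric.mem_ball] at hy hz
    linarith

theorem integrable_torusProb (f : C(Torus d, ℂ)) : Integrable f (torusProb d) :=
  Integrable.of_bound f.continuous.aestronglyMeasurable ‖f‖
    (Eventually.of_forall f.norm_coe_le_norm)

/-- Kronecker-Weyl equidistribution along nonresonant directions. -/
theorem tendsto_lineAverage_of_notMem_resonantSet (x : Torus d) {ξ : Euc d}
    (hξ : ξ ∉ resonantSet d) (f : C(Torus d, ℂ)) :
    Tendsto (lineAverage x ξ f) atTop (𝓝 (∫ y, f y ∂(torusProb d))) := by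
  have hspan : ∀ g ∈ Submodule.span ℂ (Set.range (planeWave (d := d))),
      Tendsto (lineAverage x ξ g) atTop (𝓝 (∫ y, g y ∂(torusProb d))) := by
    intro g hg
    refine Submodule.span_induction ?_ ?_ ?_ ?_ hg
    · rintro _ ⟨j, rfl⟩
      convert tendsto_lineAverage_planeWave x ξ j using 2
      rw [integral_planeWave_torusProb]
      by_cases hj : j = 0
      · simp [hj, pairing_zero, planeWave_zero]
      · rw [if_neg hj, if_neg fun h : pairing j ξ = 0 => hξ ⟨j, hj, h⟩]
    · simp only [ContinuousMap.zero_apply, integral_zero]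
      exact tendsto_const_nhds.congr fun T => (lineAverage_zero x ξ T).symm
    · intro g₁ g₂ _ _ h₁ h₂
      simp only [ContinuousMap.add_apply]
      rw [integral_add (integrable_torusProb g₁) (integrable_torusProb g₂)]
      exact (h₁.add h₂).congr fun T => (lineAverage_add x ξ g₁ g₂ T).symm
    · intro c g _ hL
      simp only [ContinuousMap.smul_apply]
      rw [integral_smul]
      exact (hL.const_mul c).congr fun T => (lineAverage_smul x ξ c g T).symm
  rw [Metric.tendsto_nhds]
  intro ε hε
  obtain ⟨g, hg, hfg⟩ := exists_mem_span_planeWave_dist_lt f (by positivity : 0 < ε / 3)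
  filter_upwards [Metric.tendsto_nhds.1 (hspan g hg) (ε / 3) (by positivity)] with T hT
  have h1 := dist_triangle4 (lineAverage x ξ f T) (lineAverage x ξ g T)
    (∫ y, g y ∂(torusProb d)) (∫ y, f y ∂(torusProb d))
  have h2 := dist_lineAverage_le x ξ f g T
  have h3 : dist (∫ y, g y ∂(torusProb d)) (∫ y, f y ∂(torusProb d)) ≤ dist f g := by
    rw [dist_comm, dist_eq_norm, dist_eq_norm,
      ← integral_sub (integrable_torusProb f) (integrable_torusProb g)]
    refine (norm_integral_le_of_norm_le_const
      (Eventually.of_forall (f - g).norm_coe_le_norm)).trans_eq ?_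
    rw [probReal_univ, mul_one]
  linarith

/-- The restriction of a symbol to a fibre `ξ = const`. -/
def symbolSlice {a : Phase d → ℂ} (ha : Continuous a) (ξ : Euc d) : C(Torus d, ℂ) :=
  ⟨fun x => a (x, ξ), ha.comp (continuous_id.prodMk continuous_const)⟩

theorem tendsto_finiteTimeAverage {a : Phase d → ℂ} (ha : Continuous a) (p : Phase d) :
    Tendsto (fun T : ℝ => finiteTimeAverage a T p) atTop (𝓝 (geodesicAverage a p)) :=
  tendsto_nhds_limUnder (exists_tendsto_lineAverage p.1 p.2 (symbolSlice ha p.2))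

theorem geodesicAverage_of_notMem_resonantSet {a : Phase d → ℂ} (ha : Continuous a) {p : Phase d}
    (hp : p.2 ∉ resonantSet d) : geodesicAverage a p = ∫ x, a (x, p.2) ∂(torusProb d) :=
  tendsto_nhds_unique (tendsto_finiteTimeAverage ha p)
    (tendsto_lineAverage_of_notMem_resonantSet p.1 hp (symbolSlice ha p.2))

theorem continuous_finiteTimeAverage {a : Phase d → ℂ} (ha : Continuous a) (T : ℝ) :
    Continuous (finiteTimeAverage a T) := by
  refine continuous_const.mul
    (intervalIntegral.continuous_parametric_intervalIntegral_of_continuous ?_ continuous_const)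
  refine ha.comp (Continuous.prodMk ?_ (continuous_snd.comp continuous_fst))
  exact (continuous_fst.comp continuous_fst).add
    (continuous_proj.comp (continuous_snd.smul (continuous_snd.comp continuous_fst)))

/-- The flow preserves `ξ`, so `⟨a⟩` vanishes off the compact set `𝕋ᵈ × (ξ-projection of the
support)`. It is bounded by `sup |a|` and measurable as a limit along integer times. -/
theorem integrable_geodesicAverage {a : Phase d → ℂ} (ha : Continuous a)
    (hc : HasCompactSupport a) (μ₀ : Measure (Phase d)) [IsLocallyFiniteMeasure μ₀] :
    Integrable (geodesicAverage a) μ₀ := by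
  obtain ⟨M, hM⟩ := ha.bounded_above_of_compact_support hc
  set K : Set (Phase d) := Set.univ ×ˢ (Prod.snd '' tsupport a) with hK
  have hKc : IsCompact K := isCompact_univ.prod (hc.isCompact.image continuous_snd)
  have hmeas : AEStronglyMeasurable (geodesicAverage a) μ₀ :=
    aestronglyMeasurable_of_tendsto_ae atTop (f := fun n : ℕ => finiteTimeAverage a (n : ℝ))
      (fun n => (continuous_finiteTimeAverage ha n).aestronglyMeasurable)
      (Eventually.of_forall fun p =>
        (tendsto_finiteTimeAverage ha p).comp tendsto_natCast_atTop_atTop)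
  have hb : ∀ p, ‖geodesicAverage a p‖ ≤ M := fun p =>
    le_of_tendsto (tendsto_finiteTimeAverage ha p).norm
      (Eventually.of_forall fun T => norm_inv_mul_intervalIntegral_le (fun s => hM _) T)
  have hz : ∀ p, p ∉ K → geodesicAverage a p = 0 := by
    intro p hp
    refine tendsto_nhds_unique (tendsto_finiteTimeAverage ha p)
      (tendsto_const_nhds.congr fun T => ?_)
    have : ∀ s : ℝ, a (geodesicFlow s p) = 0 := fun s =>
      image_eq_zero_of_notMem_tsupport fun h => hp ⟨Set.mem_univ _, _, h, rfl⟩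
    simp [finiteTimeAverage, this]
  rw [← integrableOn_iff_integrable_of_support_subset (s := K) fun p hp => by
    by_contra h; exact hp (hz p h)]
  exact Measure.integrableOn_of_bounded hKc.measure_lt_top.ne hmeas (Eventually.of_forall hb)

/-- Integrating first in `x` leaves the fibre mean of `a`, which is `⟨a⟩` for `μ₀`-almost every
point. -/
theorem integral_prod_eq_integral_geodesicAverage {a : Phase d → ℂ} (ha : Continuous a)
    {μ₀ : Measure (Phase d)} [IsLocallyFiniteMeasure μ₀]
    (hΩ : μ₀ (Set.univ ×ˢ resonantSet d) = 0)
    (hi : Integrable a ((torusProb d).prod (μ₀.map Prod.snd))) :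
    ∫ p, a p ∂((torusProb d).prod (μ₀.map Prod.snd)) = ∫ p, geodesicAverage a p ∂μ₀ := by
  rw [integral_prod_symm _ hi, integral_map measurable_snd.aemeasurable
    hi.integral_prod_right.aestronglyMeasurable]
  refine integral_congr_ae ?_
  filter_upwards [measure_eq_zero_iff_ae_notMem.1 hΩ] with p hp
  exact (geodesicAverage_of_notMem_resonantSet ha fun h => hp ⟨Set.mem_univ _, h⟩).symm

end GeodesicAverages

end TorusSemiclassical

theorem proposition5 (d : ℕ) (h α : ℕ → ℝ)
    (h_pos : ∀ n, 0 < h n) (h_lim : Tendsto h atTop (𝓝 0))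
    (α_pos : ∀ n, 0 < α n) (α_lim : Tendsto α atTop atTop)
    (u : ℕ → TorusSemiclassical.L2 d) (u_bdd : ∃ C : ℝ, ∀ n, ‖u n‖ ≤ C)
    (u_osc : TorusSemiclassical.IsHOscillating h u)
    (μ₀ : Measure (TorusSemiclassical.Phase d)) [IsLocallyFiniteMeasure μ₀]
    (hμ₀ : TorusSemiclassical.IsSemiclassicalMeasure h u μ₀)
    (μ : ℝ → Measure (TorusSemiclassical.Phase d))
    (μ_Linfty : TorusSemiclassical.IsLInftyMeasureValued μ)
    (hμ : TorusSemiclassical.IsEvolutionMeasure h α u μ)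
    (hΩ : μ₀ (Set.univ ×ˢ TorusSemiclassical.resonantSet d) = 0) :
    (∀ a : TorusSemiclassical.Phase d → ℂ, TorusSemiclassical.IsSymbol a →
      (∀ p, Tendsto (fun T : ℝ => TorusSemiclassical.finiteTimeAverage a T p) atTop
        (𝓝 (TorusSemiclassical.geodesicAverage a p))) ∧
      Integrable (TorusSemiclassical.geodesicAverage a) μ₀) ∧
    ∀ᵐ t : ℝ, ∀ a : TorusSemiclassical.Phase d → ℂ, TorusSemiclassical.IsSymbol a →
      ∫ p, a p ∂(μ t) = ∫ p, TorusSemiclassical.geodesicAverage a p ∂μ₀ := by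
  refine ⟨fun a ha => ⟨TorusSemiclassical.tendsto_finiteTimeAverage ha.continuous,
    TorusSemiclassical.integrable_geodesicAverage ha.continuous ha.2 μ₀⟩, ?_⟩
  obtain ⟨C, hC⟩ := u_bdd
  -- The null set of times comes from an identity of measures, so it does not depend on `a`.
  filter_upwards [TorusSemiclassical.ae_eq_prod h_pos h_lim α_lim hC hμ₀ μ_Linfty hμ hΩ]
    with t ht a ha
  obtain ⟨hfin, heq⟩ := ht
  have hi : Integrable a (μ t) := ha.continuous.integrable_of_hasCompactSupport ha.2
  rw [heq] at hi ⊢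
  exact TorusSemiclassical.integral_prod_eq_integral_geodesicAverage ha.continuous hΩ hi
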